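/- Let $\{X_{n,i}\}_{n,i\ge 1}$ be i.i.d. and $\{Y_n\}_{n\ge 1}$ be i.i.d. random variables with values in $\{0,1,2,\dots\}$, the two families being independent of each other, with $a_j=P(X_{1,1}=j)$, $b_j=P(Y_1=j)$, $A(x)=\sum_j a_jx^j$, $B(x)=\sum_j b_jx^j$. Let $Z_0=0$ and $Z_{n}=\sum_{i=1}^{Z_{n-1}}X_{n,i}+Y_{n}$ for $n\ge1$, and let $H_n(x)=E(x^{Z_n})$. Assume (H) $0<a_0<1$, $0<b_0<1$, $\sum_j a_jj^2\log j<\infty$, $\sum_j b_jj^2<\infty$, $E X_{1,1}=1$, $0<\beta:=B'(1-)<\infty$, $0<\gamma:=\tfrac12A''(1-)<\infty$, and $0<D(Y_1)<\infty$, where $D$ denotes variance. Put $\sigma=\beta/\gamma$. Let $$J_n=D\Big(\frac{Z_{n+1}}{Z_n}\,\Big|\,Z_n>0\Big)$$ be the variance of $Z_{n+1}/Z_n$ under the conditional probability $P(\,\cdot\mid Z_n>0)$, and let $$\bar J_n=\sum_{k\ge1}P(Z_n=k\mid Z_n>0)\,D\Big(\frac{Z_{n+1}}{Z_n}\,\Big|\,Z_n=k\Big)$$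 be the conditional mean, given $Z_n>0$, of the variance of $Z_{n+1}/Z_n$ given the value of $Z_n$ (terms with $P(Z_n=k)=0$ are $0$). Then, as $n\to\infty$: (1) If $\sigma<1$, then the limits $U(x)=\lim_n n^\sigma H_n(x)$ ($0\le x<1$) and $\mu_k=\lim_n n^\sigma P(Z_n=k)$ ($k\ge0$) exist and are finite, the function $s\mapsto (U(s)-U(0))/s$ is integrable on $(0,1)$, $\sum_{k\ge1}\mu_k/k^2$ converges, and $$J_n\sim\kappa\, n^{-\sigma},\qquad \kappa=2\gamma\int_0^1\frac{U(s)-U(0)}{s}\,ds+E(Y_1^2)\sum_{k\ge1}\frac{\mu_k}{k^2},$$ $$\bar J_n\sim\bar\kappa\, n^{-\sigma},\qquad \bar\kappa=2\gamma\int_0^1\frac{U(s)-U(0)}{s}\,ds+D(Y_1)\sum_{k\ge1}\frac{\mu_k}{k^2}.$$ (2) If $\sigma=1$, then $J_n$ and $\bar J_n$ are of exact order $\frac{\log n}{n}$: there are constants $C_1,C_2>0$ such that $C_1\frac{\log n}{n}\le J_n\le C_2\frac{\log n}{n}$ for all large $n$, and likewise for $\bar J_n$. (3) If $\sigma>1$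 and $\sigma\ne2$, then $J_n\sim\dfrac{2\gamma}{n(\beta-\gamma)}$ and $\bar J_n\sim\dfrac{2\gamma}{n(\beta-\gamma)}$. -/

import Mathlib

open Filter Topology MeasureTheory ProbabilityTheory Asymptotics

namespace GWI

noncomputable section

variable {Ω : Type*} [MeasurableSpace Ω]

/-- The branching process with immigration started from `0`. Generations and individuals are
counted from `0`, so `X n i` is the number of children of the `i`-th individual of generation `n`,
and `Y n` is the number of immigrants arriving in generation `n + 1`. -/
def Z (X : ℕ → ℕ → Ω → ℕ) (Y : ℕ → Ω → ℕ) : ℕ → Ω → ℕ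
  | 0, _ => 0
  | n + 1, ω => (∑ i ∈ Finset.range (Z X Y n ω), X n i ω) + Y n ω

/-- The offspring numbers are identically distributed, the immigration numbers are identically
distributed, and all of these random variables are mutually independent. -/
structure IsGWI (P : Measure Ω) (X : ℕ → ℕ → Ω → ℕ) (Y : ℕ → Ω → ℕ) : Prop where
  measurable_X : ∀ n i, Measurable (X n i)
  measurable_Y : ∀ n, Measurable (Y n)
  identDistrib_X : ∀ n i, IdentDistrib (X n i) (X 0 0) P P
  identDistrib_Y : ∀ n, IdentDistrib (Y n) (Y 0) P P
  indep : iIndepFun (fun s : (ℕ × ℕ) ⊕ ℕ => Sum.elim (fun p => X p.1 p.2) Y s) P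

/-- The probability mass function `j ↦ P (W = j)` of an `ℕ`-valued random variable. -/
def pmf (P : Measure Ω) (W : Ω → ℕ) (j : ℕ) : ℝ := P.real {ω | W ω = j}

/-- The probability generating function `x ↦ ∑ j, P (W = j) x ^ j`. -/
def pgf (P : Measure Ω) (W : Ω → ℕ) (x : ℝ) : ℝ := ∑' j : ℕ, pmf P W j * x ^ j

/-- The standing assumption on the offspring variable `ξ` and the immigration variable `η`:
criticality, moment conditions, and the values `β = B'(1-)` and `2γ = A''(1-)` as left limits,
where `A` and `B` are the generating functions of `ξ` and `η`. -/
structure HypH (P : Measure Ω) (ξ η : Ω → ℕ) (β γ : ℝ) : Prop where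
  a_zero : 0 < pmf P ξ 0 ∧ pmf P ξ 0 < 1
  b_zero : 0 < pmf P η 0 ∧ pmf P η 0 < 1
  summable_a : Summable fun j : ℕ => pmf P ξ j * (j : ℝ) ^ 2 * Real.log j
  summable_b : Summable fun j : ℕ => pmf P η j * (j : ℝ) ^ 2
  critical : ∫ ω, (ξ ω : ℝ) ∂P = 1
  tendsto_β : Tendsto (deriv (pgf P η)) (𝓝[<] 1) (𝓝 β)
  β_pos : 0 < β
  tendsto_γ : Tendsto (deriv (deriv (pgf P ξ))) (𝓝[<] 1) (𝓝 (2 * γ))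
  γ_pos : 0 < γ

/-- The ratio `Z_{n+1} / Z_n` (only used on events where `Z_n > 0`). -/
def ratio (X : ℕ → ℕ → Ω → ℕ) (Y : ℕ → Ω → ℕ) (n : ℕ) (ω : Ω) : ℝ :=
  (Z X Y (n + 1) ω : ℝ) / (Z X Y n ω : ℝ)

/-- The conditional variance of `Z_{n+1} / Z_n` given the event `Z_n > 0`, that is, its variance
under the conditional probability measure `P (· | Z_n > 0)`. -/
def J (P : Measure Ω) (X : ℕ → ℕ → Ω → ℕ) (Y : ℕ → Ω → ℕ) (n : ℕ) : ℝ :=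
  Var[ratio X Y n; P[|{ω | 0 < Z X Y n ω}]]

/-- The mean, given `Z_n > 0`, of the conditional variance of `Z_{n+1} / Z_n` given the value
of `Z_n`: `∑ k ≥ 1, P (Z_n = k | Z_n > 0) * Var (Z_{n+1} / Z_n | Z_n = k)`. -/
def meanCondVar (P : Measure Ω) (X : ℕ → ℕ → Ω → ℕ) (Y : ℕ → Ω → ℕ) (n : ℕ) : ℝ :=
  ∑' k : ℕ, pmf (P[|{ω | 0 < Z X Y n ω}]) (Z X Y n) (k + 1) *
    Var[ratio X Y n; P[|{ω | Z X Y n ω = k + 1}]]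

/-- Two-sided order comparison: the quotient `d n / e n` (with `e n` eventually positive) has
positive lower limit and finite upper limit. -/
def SameOrder (d e : ℕ → ℝ) : Prop :=
  ∃ C₁ C₂ : ℝ, 0 < C₁ ∧ 0 < C₂ ∧ ∀ᶠ n in atTop, C₁ * e n ≤ d n ∧ d n ≤ C₂ * e n

end

end GWI

/-! Conditionally on `Z_n = k`, the next generation is a sum of `k` independent offspring numbers
and one immigration number, so `Z_{n+1}/k` has mean `1 + β/k` and variance `2γ/k + D(Y)/k²`. With
`e_q = ∑_{k≥1} P(Z_n = k)/k^q` and `q₀ = P(Z_n > 0)`, summing over `k` gives the exact formulas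
`meanCondVar_eq`, `(2γe₁ + D e₂)/q₀`, and `J_eq`, `(2γe₁ + (D+β²)e₂)/q₀ - (βe₁/q₀)²`. Since `q₀ →
1`, only the asymptotics of `e₁` and `e₂` remain, and `e₁ = ∫₀¹ (H_n(s) - H_n(0))/s ds`.

The behaviour of `H_n` comes from the product `H_n(x) = ∏_{m<n} B(A_m(x))` over the iterates of `A`.
Put `R_n(x) = (1-x)/(1-A_n(x))`. Reciprocals turn iteration of `A` into addition, so `R_n(x) = 1 +
(1-x)·incrSum`, where `incrSum ~ γn`. On the other hand `1/R_n` is the product of the factors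
`(1-A(y))/(1-y)` along the orbit, and `B(y)` agrees to first order at `1` with the power `σ = β/γ`
of that factor. Hence `H_n = exp(logErrSum)·R_n^{-σ}` exactly (`genZ_eq`), and the logarithmic
errors are summable uniformly in `x` (`summable_errBound`); this is where the moment `∑ a_j j² log
j` enters.

Three consequences follow: `n^σ H_n(x)` converges, `H_n(1-t/n) → (1+γt)^{-σ}`, and `H_n(x)` lies
between multiples of `(1+cn(1-x))^{-σ}` (`genZ_bounds`). For `σ < 1` the majorant `(1-s)^{-σ}` is
integrable and dominated convergence gives `n^σ e₁` and `n^σ e₂`. For `σ = 1` the bounds integrate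
to `log n / n`. For `σ > 1` the substitution `s = 1 - t/n` gives `n e₁ → ∫₀^∞ (1+γt)^{-σ} dt =
1/(β-γ)`, while `n e₂ → 0`. -/

namespace GWI

noncomputable section

/-! ### Second-order expansion of generating functions at 1. -/

/-- The generating function of a sequence of weights. -/
def gen (w : ℕ → ℝ) (x : ℝ) : ℝ := ∑' j : ℕ, w j * x ^ j

/-- The second divided difference of `x ↦ x ^ j` at `1, 1, x`. -/
def quadCoeff (j : ℕ) (x : ℝ) : ℝ := ∑ i ∈ Finset.range j, ∑ l ∈ Finset.range i, x ^ l

/-- The second order remainder of the generating function at `1`. -/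
def quadRem (w : ℕ → ℝ) (x : ℝ) : ℝ := ∑' j : ℕ, w j * quadCoeff j x

lemma pow_eq_quadCoeff (j : ℕ) (x : ℝ) :
    x ^ j = 1 - j * (1 - x) + (1 - x) ^ 2 * quadCoeff j x := by
  induction j with
  | zero => simp [quadCoeff]
  | succ j ih =>
    have h := mul_neg_geom_sum x j
    have : quadCoeff (j + 1) x = quadCoeff j x + ∑ l ∈ Finset.range j, x ^ l := by
      simp [quadCoeff, Finset.sum_range_succ]
    rw [this, mul_add, show (1 - x) ^ 2 * ∑ l ∈ Finset.range j, x ^ l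
      = (1 - x) * ((1 - x) * ∑ l ∈ Finset.range j, x ^ l) by ring, h]
    push_cast
    linear_combination ih

lemma quadCoeff_one (j : ℕ) : quadCoeff j 1 = (j : ℝ) * (j - 1) / 2 := by
  induction j with
  | zero => simp [quadCoeff]
  | succ j ih =>
    have : quadCoeff (j + 1) 1 = quadCoeff j 1 + ∑ l ∈ Finset.range j, (1 : ℝ) ^ l := by
      simp [quadCoeff, Finset.sum_range_succ]
    rw [this, ih]
    simp
    ring

lemma quadCoeff_nonneg (j : ℕ) {x : ℝ} (hx : 0 ≤ x) : 0 ≤ quadCoeff j x := by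
  unfold quadCoeff; positivity

lemma quadCoeff_mono (j : ℕ) {x y : ℝ} (hx : 0 ≤ x) (hxy : x ≤ y) :
    quadCoeff j x ≤ quadCoeff j y := by
  unfold quadCoeff; gcongr

lemma continuous_quadCoeff (j : ℕ) : Continuous (quadCoeff j) := by
  unfold quadCoeff; fun_prop

/-- There are at most `j²` terms `1 - x^l`, each bounded trivially by `1` and by Bernoulli's
inequality by `j(1-x)`. Keeping the minimum of both is what later costs only a factor `log j`. -/
lemma quadCoeff_one_sub_le (j : ℕ) {x : ℝ} (hx : 0 ≤ x) (hx1 : x ≤ 1) :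
    quadCoeff j 1 - quadCoeff j x ≤ (j : ℝ) ^ 2 * min 1 (j * (1 - x)) := by
  have hm : 0 ≤ min 1 ((j : ℝ) * (1 - x)) :=
    le_min zero_le_one (mul_nonneg (Nat.cast_nonneg _) (by linarith))
  have key : ∀ l < j, 1 - x ^ l ≤ min 1 ((j : ℝ) * (1 - x)) := by
    intro l hl
    refine le_min (by linarith [pow_nonneg hx l]) ?_
    have h := one_add_mul_le_pow (a := x - 1) (by linarith) l
    have h2 : (l : ℝ) * (1 - x) ≤ j * (1 - x) := by
      have : (l : ℝ) ≤ j := by exact_mod_cast hl.le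
      exact mul_le_mul_of_nonneg_right this (by linarith)
    rw [show 1 + (x - 1) = x by ring] at h
    linarith
  have : quadCoeff j 1 - quadCoeff j x
      = ∑ i ∈ Finset.range j, ∑ l ∈ Finset.range i, (1 - x ^ l) := by
    simp [quadCoeff, Finset.sum_sub_distrib]
  rw [this]
  calc ∑ i ∈ Finset.range j, ∑ l ∈ Finset.range i, (1 - x ^ l)
      ≤ ∑ i ∈ Finset.range j, ∑ l ∈ Finset.range i, min 1 ((j : ℝ) * (1 - x)) := by
        refine Finset.sum_le_sum fun i hi => Finset.sum_le_sum fun l hl => key l ?_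
        exact (Finset.mem_range.1 hl).trans (Finset.mem_range.1 hi)
    _ = ∑ i ∈ Finset.range j, (i : ℝ) * min 1 ((j : ℝ) * (1 - x)) := by simp
    _ ≤ ∑ i ∈ Finset.range j, (j : ℝ) * min 1 ((j : ℝ) * (1 - x)) := by
        refine Finset.sum_le_sum fun i hi => ?_
        have : (i : ℝ) ≤ j := by exact_mod_cast (Finset.mem_range.1 hi).le
        exact mul_le_mul_of_nonneg_right this hm
    _ = _ := by simp; ring

/-- Probability weights with mean `m` and second factorial moment `2 r`. -/
structure HasMoments (w : ℕ → ℝ) (m r : ℝ) : Prop where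
  nonneg : ∀ j, 0 ≤ w j
  total : HasSum w 1
  mean : HasSum (fun j : ℕ => w j * j) m
  half : HasSum (fun j : ℕ => w j * quadCoeff j 1) r

namespace HasMoments

variable {w : ℕ → ℝ} {m r : ℝ}

lemma summable_quad (h : HasMoments w m r) {x : ℝ} (hx : 0 ≤ x) (hx1 : x ≤ 1) :
    Summable fun j : ℕ => w j * quadCoeff j x :=
  Summable.of_nonneg_of_le (fun j => mul_nonneg (h.nonneg j) (quadCoeff_nonneg j hx))
    (fun j => mul_le_mul_of_nonneg_left (quadCoeff_mono j hx hx1) (h.nonneg j)) h.half.summable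

lemma summable_pow (h : HasMoments w m r) {x : ℝ} (hx : 0 ≤ x) (hx1 : x ≤ 1) :
    Summable fun j : ℕ => w j * x ^ j :=
  Summable.of_nonneg_of_le (fun j => mul_nonneg (h.nonneg j) (pow_nonneg hx j))
    (fun j => mul_le_of_le_one_right (h.nonneg j) (pow_le_one₀ hx hx1)) h.total.summable

lemma gen_eq (h : HasMoments w m r) {x : ℝ} (hx : 0 ≤ x) (hx1 : x ≤ 1) :
    gen w x = 1 - m * (1 - x) + (1 - x) ^ 2 * quadRem w x := by
  have h3 := ((h.summable_quad hx hx1).hasSum.mul_left ((1 - x) ^ 2))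
  have := (h.total.sub (h.mean.mul_right (1 - x))).add h3
  refine HasSum.tsum_eq (this.congr_fun ?_)
  intro j
  rw [pow_eq_quadCoeff j x]; ring

lemma quadRem_nonneg (h : HasMoments w m r) {x : ℝ} (hx : 0 ≤ x) : 0 ≤ quadRem w x :=
  tsum_nonneg fun j => mul_nonneg (h.nonneg j) (quadCoeff_nonneg j hx)

lemma quadRem_one (h : HasMoments w m r) : quadRem w 1 = r := h.half.tsum_eq

lemma quadRem_mono (h : HasMoments w m r) {x y : ℝ} (hx : 0 ≤ x) (hxy : x ≤ y) (hy : y ≤ 1) :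
    quadRem w x ≤ quadRem w y :=
  (h.summable_quad hx (hxy.trans hy)).tsum_le_tsum
    (fun j => mul_le_mul_of_nonneg_left (quadCoeff_mono j hx hxy) (h.nonneg j))
    (h.summable_quad (hx.trans hxy) hy)

lemma quadRem_le (h : HasMoments w m r) {x : ℝ} (hx : 0 ≤ x) (hx1 : x ≤ 1) : quadRem w x ≤ r :=
  h.quadRem_one ▸ h.quadRem_mono hx hx1 le_rfl

lemma quadRem_zero (h : HasMoments w m r) : gen w 0 = 1 - m + quadRem w 0 := by
  have := h.gen_eq le_rfl zero_le_one
  simpa using this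

lemma gen_zero : gen w 0 = w 0 := by
  unfold gen
  rw [tsum_eq_single 0]
  · simp
  · intro j hj; simp [hj]

lemma gen_one (h : HasMoments w m r) : gen w 1 = 1 := by
  have := h.gen_eq zero_le_one le_rfl
  simpa using this

lemma gen_mono (h : HasMoments w m r) {x y : ℝ} (hx : 0 ≤ x) (hxy : x ≤ y) (hy : y ≤ 1) :
    gen w x ≤ gen w y :=
  (h.summable_pow hx (hxy.trans hy)).tsum_le_tsum
    (fun j => mul_le_mul_of_nonneg_left (pow_le_pow_left₀ hx hxy j) (h.nonneg j))
    (h.summable_pow (hx.trans hxy) hy)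

lemma gen_nonneg (h : HasMoments w m r) {x : ℝ} (hx : 0 ≤ x) : 0 ≤ gen w x :=
  tsum_nonneg fun j => mul_nonneg (h.nonneg j) (pow_nonneg hx j)

lemma le_gen (h : HasMoments w m r) {x : ℝ} (hx : 0 ≤ x) (hx1 : x ≤ 1) : w 0 ≤ gen w x := by
  rw [← gen_zero (w := w)]; exact h.gen_mono le_rfl hx hx1

lemma gen_le_one (h : HasMoments w m r) {x : ℝ} (hx : 0 ≤ x) (hx1 : x ≤ 1) : gen w x ≤ 1 := by
  rw [← h.gen_one]; exact h.gen_mono hx hx1 le_rfl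

/-- Because `x^j ≤ x` for `j ≥ 1`. For the offspring law this keeps `contr` above `1 - a 0`,
uniformly in `x`. -/
lemma gen_le_affine (h : HasMoments w m r) {x : ℝ} (hx : 0 ≤ x) (hx1 : x ≤ 1) :
    1 - gen w x ≥ (1 - w 0) * (1 - x) := by
  have h1 : HasSum (fun j => w j * (1 - x ^ j)) (1 - gen w x) := by
    refine (h.total.sub (h.summable_pow hx hx1).hasSum).congr_fun ?_
    intro j; ring
  have h2 : HasSum (fun j => (w j - if j = 0 then w 0 else 0) * (1 - x)) ((1 - w 0) * (1 - x)) := by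
    exact (h.total.sub (hasSum_ite_eq 0 (w 0))).mul_right _
  refine hasSum_le (fun j => ?_) h2 h1
  rcases Nat.eq_zero_or_pos j with rfl | hj
  · simp
  · rw [if_neg hj.ne', sub_zero]
    refine mul_le_mul_of_nonneg_left ?_ (h.nonneg j)
    have : x ^ j ≤ x := pow_le_of_le_one hx hx1 hj.ne'
    linarith

lemma tendsto_quadRem (h : HasMoments w m r) :
    Tendsto (quadRem w) (𝓝[Set.Icc 0 1] 1) (𝓝 r) := by
  rw [← h.quadRem_one]
  refine tendsto_tsum_of_dominated_convergence h.half.summable (fun j => ?_) ?_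
  · exact (((continuous_quadCoeff j).tendsto 1).const_mul (w j)).mono_left nhdsWithin_le_nhds
  · filter_upwards [self_mem_nhdsWithin] with x hx j
    rw [Real.norm_of_nonneg (mul_nonneg (h.nonneg j) (quadCoeff_nonneg j hx.1))]
    exact mul_le_mul_of_nonneg_left (quadCoeff_mono j hx.1 hx.2) (h.nonneg j)

lemma sub_quadRem_le (h : HasMoments w m r) (h2 : Summable fun j : ℕ => w j * (j : ℝ) ^ 2)
    {x : ℝ} (hx : 0 ≤ x) (hx1 : x ≤ 1) :
    r - quadRem w x ≤ ∑' j : ℕ, w j * (j : ℝ) ^ 2 * min 1 (j * (1 - x)) := by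
  have h1 := h.half.sub (h.summable_quad hx hx1).hasSum
  have hs : Summable fun j : ℕ => w j * (j : ℝ) ^ 2 * min 1 (j * (1 - x)) := by
    refine Summable.of_nonneg_of_le (fun j => ?_) (fun j => ?_) h2
    · have := h.nonneg j
      have : 0 ≤ min 1 ((j : ℝ) * (1 - x)) :=
        le_min zero_le_one (mul_nonneg (Nat.cast_nonneg _) (by linarith))
      positivity
    · exact mul_le_of_le_one_right (mul_nonneg (h.nonneg j) (by positivity)) (min_le_left _ _)
  refine hasSum_le (fun j => ?_) h1 hs.hasSum
  rw [← mul_sub, mul_assoc]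
  exact mul_le_mul_of_nonneg_left (quadCoeff_one_sub_le j hx hx1) (h.nonneg j)

end HasMoments

/-! ### Elementary estimates for logarithms and harmonic sums. -/

/-- Elementary logarithm estimate near `1`. -/
lemma abs_log_sub_le {y c : ℝ} (hc : 0 < c) (hy : c ≤ y) :
    |Real.log y - (y - 1)| ≤ (y - 1) ^ 2 / c := by
  have hy0 : 0 < y := hc.trans_le hy
  have h1 := Real.log_le_sub_one_of_pos hy0
  have h2 := Real.one_sub_inv_le_log_of_pos hy0
  have h3 : (y - 1) ^ 2 / y ≤ (y - 1) ^ 2 / c := by gcongr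
  have h4 : (y - 1) - (y - 1) ^ 2 / y = 1 - y⁻¹ := by field_simp; ring
  rw [abs_le]; constructor <;> linarith [div_nonneg (sq_nonneg (y - 1)) hc.le]

/-- Split at `m = j`: below, the minimum is at most `1` and the harmonic sum gives `1 + log j`;
above, the terms are at most `jC²/(m(m+1))`, which telescopes to at most `C²`. The bound does not
depend on `M`. -/
lemma sum_inv_mul_min_le {C : ℝ} (hC : 0 ≤ C) {j : ℕ} (hj : 1 ≤ j) (M : ℕ) :
    ∑ m ∈ Finset.range M, min 1 ((j : ℝ) * (C / (m + 1))) * (C / (m + 1))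
      ≤ C * (1 + Real.log j) + C ^ 2 := by
  have hle : ∀ m : ℕ, 0 ≤ min 1 ((j : ℝ) * (C / (m + 1))) * (C / (m + 1)) := fun m =>
    mul_nonneg (le_min zero_le_one (by positivity)) (by positivity)
  have h1 : ∑ m ∈ Finset.range M, min 1 ((j : ℝ) * (C / (m + 1))) * (C / (m + 1))
      ≤ ∑ m ∈ Finset.range (j + M), min 1 ((j : ℝ) * (C / (m + 1))) * (C / (m + 1)) :=
    Finset.sum_le_sum_of_subset_of_nonneg (Finset.range_mono (by omega)) fun m _ _ => hle m
  refine h1.trans ?_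
  rw [Finset.sum_range_add]
  refine add_le_add ?_ ?_
  · have hh := harmonic_le_one_add_log j
    have : ∑ m ∈ Finset.range j, min 1 ((j : ℝ) * (C / (m + 1))) * (C / (m + 1))
        ≤ ∑ m ∈ Finset.range j, C * ((m : ℝ) + 1)⁻¹ := by
      refine Finset.sum_le_sum fun m _ => ?_
      rw [← div_eq_mul_inv]
      exact mul_le_of_le_one_left (by positivity) (min_le_left _ _)
    refine this.trans ?_
    rw [← Finset.mul_sum]
    refine mul_le_mul_of_nonneg_left ?_ hC
    refine le_trans (le_of_eq ?_) hh
    simp [harmonic]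
  · have hb : ∀ N : ℕ, ∑ m ∈ Finset.range N, ((j : ℝ) + m + 1)⁻¹ * ((j : ℝ) + m)⁻¹
        = (j : ℝ)⁻¹ - ((j : ℝ) + N)⁻¹ := by
      intro N
      have hj0 : (0 : ℝ) < j := by exact_mod_cast hj
      induction N with
      | zero => simp
      | succ N ih =>
        rw [Finset.sum_range_succ, ih]; push_cast; field_simp; ring
    have hj0 : (0 : ℝ) < j := by exact_mod_cast hj
    have : ∑ m ∈ Finset.range M,
          min 1 ((j : ℝ) * (C / (((j + m : ℕ) : ℝ) + 1))) * (C / (((j + m : ℕ) : ℝ) + 1))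
        ≤ ∑ m ∈ Finset.range M, (j * C ^ 2) * (((j : ℝ) + m + 1)⁻¹ * ((j : ℝ) + m)⁻¹) := by
      refine Finset.sum_le_sum fun m _ => ?_
      push_cast
      calc min 1 ((j : ℝ) * (C / ((j : ℝ) + m + 1))) * (C / ((j : ℝ) + m + 1))
          ≤ ((j : ℝ) * (C / ((j : ℝ) + m + 1))) * (C / ((j : ℝ) + m)) := by
            refine mul_le_mul (min_le_right _ _) ?_ (by positivity) (by positivity)
            exact div_le_div_of_nonneg_left hC (by positivity) (by linarith)
        _ = _ := by field_simp
    refine this.trans ?_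
    rw [← Finset.mul_sum, hb]
    have : (0 : ℝ) ≤ ((j : ℝ) + M)⁻¹ := by positivity
    calc (j : ℝ) * C ^ 2 * ((j : ℝ)⁻¹ - ((j : ℝ) + M)⁻¹) ≤ (j : ℝ) * C ^ 2 * (j : ℝ)⁻¹ := by
          gcongr; linarith
      _ = C ^ 2 := by field_simp

/-! ### Orbits of the critical generating function and the product formula. -/

/-- Offspring weights `a` of a critical law with variance `2 γ` and immigration weights `b` with
mean `β`. -/
structure Critical (a b : ℕ → ℝ) (β γ ρ : ℝ) : Prop where
  offspring : HasMoments a 1 γ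
  immigration : HasMoments b β ρ
  summable_sq : Summable fun j : ℕ => a j * (j : ℝ) ^ 2
  summable_log : Summable fun j : ℕ => a j * (j : ℝ) ^ 2 * Real.log j
  a_pos : 0 < a 0
  a_lt : a 0 < 1
  b_pos : 0 < b 0
  β_pos : 0 < β
  γ_pos : 0 < γ

/-- The iterates of the offspring generating function. -/
def iter (a : ℕ → ℝ) (n : ℕ) (x : ℝ) : ℝ := (gen a)^[n] x

/-- The generating function of the `n`-th generation. -/
def genZ (a b : ℕ → ℝ) (n : ℕ) (x : ℝ) : ℝ := ∏ m ∈ Finset.range n, gen b (iter a m x)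

/-- The contraction factor `(1 - A(x)) / (1 - x)`. -/
def contr (a : ℕ → ℝ) (x : ℝ) : ℝ := 1 - (1 - x) * quadRem a x

/-- The increment of `1 / (1 - x)` under `x ↦ A(x)`. -/
def incr (a : ℕ → ℝ) (x : ℝ) : ℝ := quadRem a x / contr a x

/-- The increment of `1 / (1 - x)` under the `n`-th iterate of `A`. -/
def incrSum (a : ℕ → ℝ) (n : ℕ) (x : ℝ) : ℝ := ∑ m ∈ Finset.range n, incr a (iter a m x)

/-- The logarithmic error of one step. -/
def logErr (a b : ℕ → ℝ) (σ x : ℝ) : ℝ := Real.log (gen b x) - σ * Real.log (contr a x)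

/-- The logarithmic error of `n` steps. -/
def logErrSum (a b : ℕ → ℝ) (σ : ℝ) (n : ℕ) (x : ℝ) : ℝ :=
  ∑ m ∈ Finset.range n, logErr a b σ (iter a m x)

/-- An antitone majorant of the logarithmic error, up to a constant. -/
def errBound (a : ℕ → ℝ) (γ x : ℝ) : ℝ := (1 - x) ^ 2 + (γ - quadRem a x) * (1 - x)

lemma iter_succ (a : ℕ → ℝ) (n : ℕ) (x : ℝ) : iter a (n + 1) x = gen a (iter a n x) :=
  Function.iterate_succ_apply' _ _ _

namespace Critical

variable {a b : ℕ → ℝ} {β γ ρ : ℝ}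

lemma gen_eq (h : Critical a b β γ ρ) {x : ℝ} (hx : 0 ≤ x) (hx1 : x ≤ 1) :
    1 - gen a x = (1 - x) * contr a x := by
  rw [h.offspring.gen_eq hx hx1, contr]; ring

lemma le_gen (h : Critical a b β γ ρ) {x : ℝ} (hx : 0 ≤ x) (hx1 : x ≤ 1) : x ≤ gen a x := by
  rw [h.offspring.gen_eq hx hx1]
  nlinarith [mul_nonneg (sq_nonneg (1 - x)) (h.offspring.quadRem_nonneg hx)]

/-- Mean one makes the expansion at `x = 0` read `a 0 = quadRem a 0`, and `quadRem` is monotone. -/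
lemma a_le_quadRem (h : Critical a b β γ ρ) {x : ℝ} (hx : 0 ≤ x) (hx1 : x ≤ 1) :
    a 0 ≤ quadRem a x := by
  have h0 := h.offspring.quadRem_zero
  rw [HasMoments.gen_zero] at h0
  have := h.offspring.quadRem_mono le_rfl hx hx1
  linarith

lemma contr_le (h : Critical a b β γ ρ) {x : ℝ} (hx : 0 ≤ x) (hx1 : x ≤ 1) : contr a x ≤ 1 := by
  unfold contr
  nlinarith [mul_nonneg (sub_nonneg.2 hx1) (h.offspring.quadRem_nonneg hx)]

lemma le_contr (h : Critical a b β γ ρ) {x : ℝ} (hx : 0 ≤ x) (hx1 : x < 1) :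
    1 - a 0 ≤ contr a x := by
  have h1 := h.offspring.gen_le_affine hx hx1.le
  rw [h.gen_eq hx hx1.le, mul_comm (1 - x)] at h1
  exact le_of_mul_le_mul_right h1 (sub_pos.2 hx1)

lemma contr_pos (h : Critical a b β γ ρ) {x : ℝ} (hx : 0 ≤ x) (hx1 : x < 1) : 0 < contr a x :=
  lt_of_lt_of_le (by linarith [h.a_lt]) (h.le_contr hx hx1)

lemma gen_lt_one (h : Critical a b β γ ρ) {x : ℝ} (hx : 0 ≤ x) (hx1 : x < 1) : gen a x < 1 := by
  have := h.gen_eq hx hx1.le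
  nlinarith [mul_pos (sub_pos.2 hx1) (h.contr_pos hx hx1)]

lemma iter_mem (h : Critical a b β γ ρ) {x : ℝ} (hx : 0 ≤ x) (hx1 : x < 1) (n : ℕ) :
    0 ≤ iter a n x ∧ iter a n x < 1 := by
  induction n with
  | zero => exact ⟨hx, hx1⟩
  | succ n ih =>
    rw [iter_succ]
    exact ⟨h.offspring.gen_nonneg ih.1, h.gen_lt_one ih.1 ih.2⟩

lemma iter_mono (h : Critical a b β γ ρ) {x y : ℝ} (hx : 0 ≤ x) (hxy : x ≤ y) (hy : y < 1) (n : ℕ) :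
    iter a n x ≤ iter a n y := by
  induction n with
  | zero => exact hxy
  | succ n ih =>
    rw [iter_succ, iter_succ]
    exact h.offspring.gen_mono (h.iter_mem hx (hxy.trans_lt hy) n).1 ih
      (h.iter_mem (hx.trans hxy) hy n).2.le

lemma le_iter (h : Critical a b β γ ρ) {x : ℝ} (hx : 0 ≤ x) (hx1 : x < 1) (n : ℕ) :
    x ≤ iter a n x := by
  induction n with
  | zero => exact le_rfl
  | succ n ih =>
    rw [iter_succ]
    have := h.iter_mem hx hx1 n
    exact ih.trans (h.le_gen this.1 this.2.le)

lemma le_incr (h : Critical a b β γ ρ) {x : ℝ} (hx : 0 ≤ x) (hx1 : x < 1) : a 0 ≤ incr a x := by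
  refine (h.a_le_quadRem hx hx1.le).trans ?_
  rw [incr, le_div_iff₀ (h.contr_pos hx hx1)]
  exact mul_le_of_le_one_right (h.offspring.quadRem_nonneg hx) (h.contr_le hx hx1.le)

lemma incr_le (h : Critical a b β γ ρ) {x : ℝ} (hx : 0 ≤ x) (hx1 : x < 1) :
    incr a x ≤ γ / (1 - a 0) :=
  div_le_div₀ h.γ_pos.le (h.offspring.quadRem_le hx hx1.le) (by linarith [h.a_lt])
    (h.le_contr hx hx1)

lemma le_incrSum (h : Critical a b β γ ρ) {x : ℝ} (hx : 0 ≤ x) (hx1 : x < 1) (n : ℕ) :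
    a 0 * n ≤ incrSum a n x := by
  have := Finset.card_nsmul_le_sum (Finset.range n) (fun m => incr a (iter a m x)) (a 0)
    fun m _ => h.le_incr (h.iter_mem hx hx1 m).1 (h.iter_mem hx hx1 m).2
  rw [Finset.card_range, nsmul_eq_mul] at this
  rw [mul_comm]; exact this

lemma incrSum_le (h : Critical a b β γ ρ) {x : ℝ} (hx : 0 ≤ x) (hx1 : x < 1) (n : ℕ) :
    incrSum a n x ≤ γ / (1 - a 0) * n := by
  have := Finset.sum_le_card_nsmul (Finset.range n) (fun m => incr a (iter a m x)) (γ / (1 - a 0))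
    fun m _ => h.incr_le (h.iter_mem hx hx1 m).1 (h.iter_mem hx hx1 m).2
  rw [Finset.card_range, nsmul_eq_mul] at this
  rw [mul_comm]; exact this

lemma incrSum_nonneg (h : Critical a b β γ ρ) {x : ℝ} (hx : 0 ≤ x) (hx1 : x < 1) (n : ℕ) :
    0 ≤ incrSum a n x :=
  (mul_nonneg h.a_pos.le (Nat.cast_nonneg n)).trans (h.le_incrSum hx hx1 n)

lemma one_add_pos (h : Critical a b β γ ρ) {x : ℝ} (hx : 0 ≤ x) (hx1 : x < 1) (n : ℕ) :
    0 < 1 + (1 - x) * incrSum a n x := by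
  have := mul_nonneg (sub_nonneg.2 hx1.le) (h.incrSum_nonneg hx hx1 n)
  linarith

/-- This is `1/(1-A_n(x)) = 1/(1-x) + incrSum`, the telescoped identity `1/(1-A(y)) = 1/(1-y) + incr
a y`, with denominators cleared. -/
lemma one_sub_iter (h : Critical a b β γ ρ) {x : ℝ} (hx : 0 ≤ x) (hx1 : x < 1) (n : ℕ) :
    (1 + (1 - x) * incrSum a n x) * (1 - iter a n x) = 1 - x := by
  induction n with
  | zero => simp [incrSum, iter]
  | succ n ih =>
    have hm := h.iter_mem hx hx1 n
    have hQ := h.contr_pos hm.1 hm.2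
    rw [iter_succ, h.gen_eq hm.1 hm.2.le, incrSum, Finset.sum_range_succ]
    change (1 + (1 - x) * (incrSum a n x + incr a (iter a n x))) * _ = _
    set y := iter a n x
    have h1 : contr a y * incr a y = quadRem a y := by unfold incr; field_simp
    have h2 : contr a y = 1 - (1 - y) * quadRem a y := rfl
    linear_combination ih * contr a y + (1 - x) * (1 - y) * h1 + (1 - x) * h2

/-- Both sides are values of `(1-x)/(1-A_n(x))` for consecutive `n`, whose quotient is the
contraction factor at `A_n(x)`. -/
lemma one_add_succ (h : Critical a b β γ ρ) {x : ℝ} (hx : 0 ≤ x) (hx1 : x < 1) (n : ℕ) :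
    1 + (1 - x) * incrSum a n x
      = (1 + (1 - x) * incrSum a (n + 1) x) * contr a (iter a n x) := by
  have hm := h.iter_mem hx hx1 n
  have h1 := h.one_sub_iter hx hx1 n
  have h2 := h.one_sub_iter hx hx1 (n + 1)
  rw [iter_succ, h.gen_eq hm.1 hm.2.le] at h2
  have : (1 - iter a n x) ≠ 0 := by linarith [hm.2]
  refine mul_right_cancel₀ this ?_
  rw [h1]; linear_combination -h2

lemma genb_pos (h : Critical a b β γ ρ) {x : ℝ} (hx : 0 ≤ x) (hx1 : x ≤ 1) : 0 < gen b x :=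
  h.b_pos.trans_le (h.immigration.le_gen hx hx1)

/-- The exact product representation of the generating function of `Z_n`. -/
lemma genZ_eq (h : Critical a b β γ ρ) (σ : ℝ) {x : ℝ} (hx : 0 ≤ x) (hx1 : x < 1) (n : ℕ) :
    genZ a b n x
      = Real.exp (logErrSum a b σ n x) * (1 + (1 - x) * incrSum a n x) ^ (-σ) := by
  induction n with
  | zero => simp [genZ, logErrSum, incrSum]
  | succ n ih =>
    have hm := h.iter_mem hx hx1 n
    have hQ := h.contr_pos hm.1 hm.2
    have hB := h.genb_pos hm.1 hm.2.le
    have hR := h.one_add_pos hx hx1 (n + 1)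
    have e1 : genZ a b (n + 1) x = genZ a b n x * gen b (iter a n x) := Finset.prod_range_succ _ _
    have e2 : logErrSum a b σ (n + 1) x = logErrSum a b σ n x + logErr a b σ (iter a n x) :=
      Finset.sum_range_succ _ _
    rw [e1, ih, e2, h.one_add_succ hx hx1 n, Real.mul_rpow hR.le hQ.le, Real.exp_add, logErr,
      Real.exp_sub, Real.exp_log hB, Real.rpow_def_of_pos hQ, show Real.log (contr a (iter a n x))
      * -σ = -(σ * Real.log (contr a (iter a n x))) by ring, Real.exp_neg]
    field_simp

lemma one_sub_iter_le (h : Critical a b β γ ρ) (n : ℕ) :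
    1 - iter a n 0 ≤ (a 0)⁻¹ / (n + 1) := by
  have h1 := h.one_sub_iter le_rfl zero_lt_one n
  have h2 := h.le_incrSum le_rfl zero_lt_one n
  have h3 := (h.iter_mem le_rfl zero_lt_one n).2
  rw [le_div_iff₀ (by positivity), le_inv_comm₀ ?_ h.a_pos]
  · have hy : 0 < 1 - iter a n 0 := by linarith
    rw [mul_inv, ← div_eq_mul_inv, le_div_iff₀ (by positivity)]
    have : (1 - iter a n 0)⁻¹ = 1 + incrSum a n 0 := by
      simp only [sub_zero, one_mul] at h1
      exact inv_eq_of_mul_eq_one_left h1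
    -- `a 0 * (n + 1) ≤ 1 + a 0 * n ≤ 1 + incrSum a n 0`, the first inequality because `a 0 < 1`.
    rw [this]; nlinarith [h.a_lt]
  · have : (0 : ℝ) < n + 1 := by positivity
    exact mul_pos (by linarith) this

/-- Monotonicity gives uniformity: the orbit of any `x ≥ 0` stays above the orbit of `0`, so its
errors are dominated by those along the orbit of `0`. -/
lemma errBound_anti (h : Critical a b β γ ρ) {x y : ℝ} (hx : 0 ≤ x) (hxy : x ≤ y) (hy : y ≤ 1) :
    errBound a γ y ≤ errBound a γ x := by
  unfold errBound
  have h1 := h.offspring.quadRem_mono hx hxy hy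
  have h2 := h.offspring.quadRem_le (hx.trans hxy) hy
  have h3 : (1 - y) ^ 2 ≤ (1 - x) ^ 2 := pow_le_pow_left₀ (by linarith) (by linarith) 2
  have h4 : (γ - quadRem a y) * (1 - y) ≤ (γ - quadRem a x) * (1 - x) :=
    mul_le_mul (by linarith) (by linarith) (by linarith) (by linarith)
  linarith

lemma errBound_nonneg (h : Critical a b β γ ρ) {x : ℝ} (hx : 0 ≤ x) (hx1 : x ≤ 1) :
    0 ≤ errBound a γ x :=
  add_nonneg (sq_nonneg _) (mul_nonneg (sub_nonneg.2 (h.offspring.quadRem_le hx hx1))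
    (by linarith))

lemma errBound_le (h : Critical a b β γ ρ) {x : ℝ} (hx : 0 ≤ x) (hx1 : x ≤ 1) :
    errBound a γ x ≤ (1 + γ) * (1 - x) := by
  unfold errBound
  nlinarith [mul_nonneg (h.offspring.quadRem_nonneg hx) (sub_nonneg.2 hx1)]

/-- The exponent `β/γ` is the one for which the first-order terms `-β(1-x)` and `(β/γ)·γ(1-x)`
cancel. What is left is quadratic, apart from `(β/γ)(γ - quadRem a x)(1-x)`. -/
lemma abs_logErr_le (h : Critical a b β γ ρ) :
    ∃ C, 0 ≤ C ∧ ∀ x, 0 ≤ x → x < 1 → |logErr a b (β / γ) x| ≤ C * errBound a γ x := by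
  have hβ := h.β_pos
  have hγ := h.γ_pos
  have hb := h.b_pos
  have ha : 0 < 1 - a 0 := by linarith [h.a_lt]
  have hρ : 0 ≤ ρ := (h.immigration.quadRem_nonneg zero_le_one).trans
    (h.immigration.quadRem_le zero_le_one le_rfl)
  set K := β ^ 2 / b 0 + ρ + β / γ * (γ ^ 2 / (1 - a 0)) with hK
  refine ⟨K + β / γ, by positivity, fun x hx hx1 => ?_⟩
  have hQ := h.le_contr hx hx1
  have hB := h.immigration.le_gen hx hx1.le
  have l1 := abs_log_sub_le hb hB
  have l2 := abs_log_sub_le ha hQ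
  have eB := h.immigration.gen_eq hx hx1.le
  have R0 := h.immigration.quadRem_nonneg hx
  have R1 := h.immigration.quadRem_le hx hx1.le
  have G0 := h.offspring.quadRem_nonneg hx
  have G1 := h.offspring.quadRem_le hx hx1.le
  have B1 := h.immigration.gen_le_one hx hx1.le
  have hB2 : (gen b x - 1) ^ 2 ≤ β ^ 2 * (1 - x) ^ 2 := by
    rw [← mul_pow, ← neg_sq]
    refine pow_le_pow_left₀ (by linarith) ?_ 2
    nlinarith [mul_nonneg (sq_nonneg (1 - x)) R0]
  have hQ2 : (contr a x - 1) ^ 2 ≤ γ ^ 2 * (1 - x) ^ 2 := by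
    rw [← mul_pow, ← neg_sq]
    refine pow_le_pow_left₀ (by linarith [h.contr_le hx hx1.le]) ?_ 2
    unfold contr
    nlinarith [mul_le_mul_of_nonneg_left G1 (sub_nonneg.2 hx1.le)]
  have key : logErr a b (β / γ) x = (Real.log (gen b x) - (gen b x - 1))
      - β / γ * (Real.log (contr a x) - (contr a x - 1)) + (1 - x) ^ 2 * quadRem b x
      - β / γ * ((γ - quadRem a x) * (1 - x)) := by
    rw [logErr, eB, contr]; field_simp; ring
  have t1 : |Real.log (gen b x) - (gen b x - 1)| ≤ β ^ 2 / b 0 * (1 - x) ^ 2 := by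
    refine l1.trans ?_
    rw [div_mul_eq_mul_div]; gcongr
  have t2 : |β / γ * (Real.log (contr a x) - (contr a x - 1))|
      ≤ β / γ * (γ ^ 2 / (1 - a 0)) * (1 - x) ^ 2 := by
    rw [abs_mul, abs_of_pos (by positivity : 0 < β / γ), mul_assoc]
    refine mul_le_mul_of_nonneg_left (l2.trans ?_) (by positivity)
    rw [div_mul_eq_mul_div]; gcongr
  have t3 : |(1 - x) ^ 2 * quadRem b x| ≤ ρ * (1 - x) ^ 2 := by
    rw [abs_of_nonneg (by positivity), mul_comm]; gcongr
  have e0 : 0 ≤ (γ - quadRem a x) * (1 - x) := mul_nonneg (by linarith) (by linarith)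
  have t4 : |β / γ * ((γ - quadRem a x) * (1 - x))| ≤ β / γ * ((γ - quadRem a x) * (1 - x)) := by
    rw [abs_of_nonneg (by positivity)]
  rw [key]
  calc _ ≤ β ^ 2 / b 0 * (1 - x) ^ 2 + β / γ * (γ ^ 2 / (1 - a 0)) * (1 - x) ^ 2
          + ρ * (1 - x) ^ 2 + β / γ * ((γ - quadRem a x) * (1 - x)) := by
        refine (abs_sub _ _).trans (add_le_add ((abs_add_le _ _).trans (add_le_add
          ((abs_sub _ _).trans (add_le_add t1 t2)) t3)) t4)
    _ = K * (1 - x) ^ 2 + β / γ * ((γ - quadRem a x) * (1 - x)) := by rw [hK]; ring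
    _ ≤ (K + β / γ) * errBound a γ x := by
        unfold errBound
        have : 0 ≤ K := by positivity
        have : 0 ≤ β / γ := by positivity
        nlinarith [mul_nonneg ‹0 ≤ K› e0, mul_nonneg this (sq_nonneg (1 - x))]

/-- Since `1 - A_m(0) ≤ C/(m+1)`, the quadratic part is summable. In the other part, summing over
`m` before `j` bounds the coefficient of `a_j j²` by `C(1 + log j) + C²`, which the logarithmic
moment makes summable. -/
lemma summable_errBound (h : Critical a b β γ ρ) :
    Summable fun n => errBound a γ (iter a n 0) := by
  have ha := h.a_pos
  set C := (a 0)⁻¹ with hC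
  have hC0 : 0 < C := inv_pos.2 ha
  have hmem := fun n => h.iter_mem le_rfl zero_lt_one n
  refine Summable.add ?_ ?_
  · have hs : Summable fun n : ℕ => C ^ 2 * (1 / ((n : ℝ) + 1) ^ 2) := by
      have := (summable_nat_add_iff 1).2 (Real.summable_one_div_nat_pow.2 one_lt_two)
      exact (this.congr fun n => by push_cast; rfl).mul_left _
    refine Summable.of_nonneg_of_le (fun n => sq_nonneg _) (fun n => ?_) hs
    have := pow_le_pow_left₀ (by linarith [(hmem n).2]) (h.one_sub_iter_le n) 2
    rw [div_pow] at this
    rw [mul_one_div]; exact this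
  · set T : ℕ → ℝ := fun j => a j * (j : ℝ) ^ 2 * (C * (1 + Real.log j) + C ^ 2) with hT
    have hTs : Summable T := by
      refine ((h.summable_log.mul_left C).add (h.summable_sq.mul_left (C + C ^ 2))).congr ?_
      intro j; rw [hT]; ring
    have hmin : ∀ (j m : ℕ), 0 ≤ min 1 ((j : ℝ) * (C / (m + 1))) := fun j m =>
      le_min zero_le_one (by positivity)
    have hsm : ∀ m : ℕ, Summable fun j : ℕ =>
        a j * (j : ℝ) ^ 2 * (min 1 ((j : ℝ) * (C / (m + 1))) * (C / (m + 1))) := by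
      intro m
      refine Summable.of_nonneg_of_le (fun j => ?_) (fun j => ?_)
        (h.summable_sq.mul_right (C / (m + 1)))
      · have := h.offspring.nonneg j
        have := hmin j m
        positivity
      · have := h.offspring.nonneg j
        refine mul_le_mul_of_nonneg_left ?_ (by positivity)
        exact mul_le_of_le_one_left (by positivity) (min_le_left _ _)
    have hterm : ∀ m : ℕ, (γ - quadRem a (iter a m 0)) * (1 - iter a m 0) ≤
        ∑' j : ℕ, a j * (j : ℝ) ^ 2 * (min 1 ((j : ℝ) * (C / (m + 1))) * (C / (m + 1))) := by
      intro m
      have h1 := h.offspring.sub_quadRem_le h.summable_sq (hmem m).1 (hmem m).2.le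
      have h2 := h.one_sub_iter_le m
      have h3 : ∑' j : ℕ, a j * (j : ℝ) ^ 2 * min 1 (j * (1 - iter a m 0))
          ≤ ∑' j : ℕ, a j * (j : ℝ) ^ 2 * min 1 (j * (C / (m + 1))) := by
        have hs : ∀ y : ℝ, 0 ≤ y → Summable fun j : ℕ => a j * (j : ℝ) ^ 2 * min 1 (j * y) := by
          intro y hy
          refine Summable.of_nonneg_of_le (fun j => ?_) (fun j => ?_) h.summable_sq
          · exact mul_nonneg (mul_nonneg (h.offspring.nonneg j) (by positivity))
              (le_min zero_le_one (by positivity))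
          · exact mul_le_of_le_one_right (mul_nonneg (h.offspring.nonneg j) (by positivity))
              (min_le_left _ _)
        refine (hs _ (by linarith [(hmem m).2])).tsum_le_tsum (fun j => ?_) (hs _ (by positivity))
        refine mul_le_mul_of_nonneg_left ?_ (mul_nonneg (h.offspring.nonneg j) (by positivity))
        exact min_le_min_left _ (mul_le_mul_of_nonneg_left h2 (Nat.cast_nonneg j))
      calc _ ≤ (∑' j : ℕ, a j * (j : ℝ) ^ 2 * min 1 (j * (C / (m + 1)))) * (C / (m + 1)) := by
            refine mul_le_mul (h1.trans h3) h2 (by linarith [(hmem m).2]) ?_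
            exact tsum_nonneg fun j => mul_nonneg (mul_nonneg (h.offspring.nonneg j)
              (by positivity)) (hmin j m)
        _ = _ := by rw [← tsum_mul_right]; simp only [mul_assoc]
    refine summable_of_sum_range_le (c := ∑' j, T j) (fun m => ?_) (fun M => ?_)
    · exact mul_nonneg (sub_nonneg.2 (h.offspring.quadRem_le (hmem m).1 (hmem m).2.le))
        (by linarith [(hmem m).2])
    · refine (Finset.sum_le_sum fun m _ => hterm m).trans ?_
      rw [← Summable.tsum_finsetSum fun m _ => hsm m]
      refine (summable_sum fun m _ => hsm m).tsum_le_tsum (fun j => ?_) hTs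
      rw [← Finset.mul_sum]
      rcases Nat.eq_zero_or_pos j with rfl | hj
      · simp [hT]
      · exact mul_le_mul_of_nonneg_left (sum_inv_mul_min_le hC0.le hj M)
          (mul_nonneg (h.offspring.nonneg j) (by positivity))

lemma abs_logErr_iter_le (h : Critical a b β γ ρ) {C : ℝ} (hC : 0 ≤ C)
    (hb : ∀ x, 0 ≤ x → x < 1 → |logErr a b (β / γ) x| ≤ C * errBound a γ x)
    {x : ℝ} (hx : 0 ≤ x) (hx1 : x < 1) (m : ℕ) :
    |logErr a b (β / γ) (iter a m x)| ≤ C * errBound a γ (iter a m 0) := by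
  have hm := h.iter_mem hx hx1 m
  exact (hb _ hm.1 hm.2).trans (mul_le_mul_of_nonneg_left (h.errBound_anti
    (h.iter_mem le_rfl zero_lt_one m).1 (h.iter_mono le_rfl hx hx1 m) hm.2.le) hC)

lemma abs_logErrSum_le (h : Critical a b β γ ρ) :
    ∃ K, ∀ x, 0 ≤ x → x < 1 → ∀ n, |logErrSum a b (β / γ) n x| ≤ K := by
  obtain ⟨C, hC, hb⟩ := h.abs_logErr_le
  refine ⟨∑' m, C * errBound a γ (iter a m 0), fun x hx hx1 n => ?_⟩
  refine (Finset.abs_sum_le_sum_abs _ _).trans ((Finset.sum_le_sum fun m _ =>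
    h.abs_logErr_iter_le hC hb hx hx1 m).trans ?_)
  refine (h.summable_errBound.mul_left C).sum_le_tsum _ fun m _ => ?_
  have hm := h.iter_mem le_rfl zero_lt_one m
  exact mul_nonneg hC (h.errBound_nonneg hm.1 hm.2.le)

lemma tendsto_logErrSum (h : Critical a b β γ ρ) {x : ℝ} (hx : 0 ≤ x) (hx1 : x < 1) :
    Tendsto (fun n => logErrSum a b (β / γ) n x) atTop
      (𝓝 (∑' m, logErr a b (β / γ) (iter a m x))) := by
  obtain ⟨C, hC, hb⟩ := h.abs_logErr_le
  refine (Summable.of_norm_bounded (h.summable_errBound.mul_left C)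
    fun m => ?_).hasSum.tendsto_sum_nat
  exact h.abs_logErr_iter_le hC hb hx hx1 m

/-- Dominated convergence for the sum over `m`, cut off at `n`: each term is at most a constant
times `1 - x n`, because iterates only move towards `1`, and the orbit of `0` supplies the summable
majorant. -/
lemma tendsto_logErrSum_zero (h : Critical a b β γ ρ) {x : ℕ → ℝ}
    (hx : ∀ᶠ n in atTop, 0 ≤ x n ∧ x n < 1) (hlim : Tendsto x atTop (𝓝 1)) :
    Tendsto (fun n => logErrSum a b (β / γ) n (x n)) atTop (𝓝 0) := by
  obtain ⟨C, hC, hb⟩ := h.abs_logErr_le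
  have key : Tendsto (fun n => ∑' m, if m < n then logErr a b (β / γ) (iter a m (x n)) else 0)
      atTop (𝓝 (∑' _ : ℕ, (0 : ℝ))) := by
    refine tendsto_tsum_of_dominated_convergence (h.summable_errBound.mul_left C)
      (fun m => ?_) ?_
    · have h0 : Tendsto (fun n => C * ((1 + γ) * (1 - x n))) atTop (𝓝 0) := by
        have := (((tendsto_const_nhds (x := (1 : ℝ))).sub hlim).const_mul (1 + γ)).const_mul C
        simpa using this
      refine squeeze_zero_norm' ?_ h0
      filter_upwards [hx] with n hn
      have hm := h.iter_mem hn.1 hn.2 m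
      have hbd : |logErr a b (β / γ) (iter a m (x n))| ≤ C * ((1 + γ) * (1 - x n)) := by
        refine (hb _ hm.1 hm.2).trans (mul_le_mul_of_nonneg_left ?_ hC)
        exact (h.errBound_anti hn.1 (h.le_iter hn.1 hn.2 m) hm.2.le).trans
          (h.errBound_le hn.1 hn.2.le)
      split_ifs
      · exact hbd
      · rw [norm_zero]; exact (abs_nonneg _).trans hbd
    · filter_upwards [hx] with n hn m
      have := h.abs_logErr_iter_le hC hb hn.1 hn.2 m
      split_ifs
      · exact this
      · rw [norm_zero]; exact (abs_nonneg _).trans this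
  rw [tsum_zero] at key
  refine key.congr fun n => ?_
  rw [tsum_eq_sum (s := Finset.range n)]
  · exact Finset.sum_congr rfl fun m hm => if_pos (Finset.mem_range.1 hm)
  · intro m hm; exact if_neg fun hlt => hm (Finset.mem_range.2 hlt)

lemma tendsto_iter_zero (h : Critical a b β γ ρ) :
    Tendsto (fun n => iter a n 0) atTop (𝓝 1) := by
  have h0 : Tendsto (fun n : ℕ => (a 0)⁻¹ / ((n : ℝ) + 1)) atTop (𝓝 0) :=
    tendsto_const_nhds.div_atTop (tendsto_atTop_add_const_right _ _ tendsto_natCast_atTop_atTop)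
  have := squeeze_zero (fun n => by linarith [(h.iter_mem le_rfl zero_lt_one n).2])
    (fun n => h.one_sub_iter_le n) h0
  simpa using (tendsto_const_nhds (x := (1 : ℝ))).sub this

/-- A Cesàro mean: `incr a y → γ` as `y → 1`. The starting point may vary with `n` because the error
is controlled by a decreasing modulus `ω`, evaluated on the orbit of `0`. -/
lemma tendsto_incrSum_div (h : Critical a b β γ ρ) {x : ℕ → ℝ}
    (hx : ∀ᶠ n in atTop, 0 ≤ x n ∧ x n < 1) :
    Tendsto (fun n => incrSum a n (x n) / n) atTop (𝓝 γ) := by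
  have ha : 0 < 1 - a 0 := by linarith [h.a_lt]
  have hγ := h.γ_pos
  have hmem := fun n => h.iter_mem le_rfl zero_lt_one n
  set ω : ℝ → ℝ := fun y => (γ - quadRem a y) + γ ^ 2 / (1 - a 0) * (1 - y) with hω
  have hωlim : Tendsto (fun n => ω (iter a n 0)) atTop (𝓝 0) := by
    have h1 : Tendsto (fun n => quadRem a (iter a n 0)) atTop (𝓝 γ) :=
      h.offspring.tendsto_quadRem.comp (tendsto_nhdsWithin_iff.2 ⟨h.tendsto_iter_zero,
        Eventually.of_forall fun n => ⟨(hmem n).1, (hmem n).2.le⟩⟩)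
    have := ((tendsto_const_nhds (x := γ)).sub h1).add
      (((tendsto_const_nhds (x := (1 : ℝ))).sub h.tendsto_iter_zero).const_mul (γ ^ 2 / (1 - a 0)))
    simpa using this
  have hinc : ∀ y, 0 ≤ y → y < 1 → |incr a y - γ| ≤ ω y := by
    intro y hy hy1
    have G1 := h.offspring.quadRem_le hy hy1.le
    have G0 := h.offspring.quadRem_nonneg hy
    have hQ := h.contr_pos hy hy1
    have hQ1 := h.contr_le hy hy1.le
    have hQ2 := h.le_contr hy hy1
    have l1 : quadRem a y ≤ incr a y := by
      rw [incr, le_div_iff₀ hQ]; exact mul_le_of_le_one_right G0 hQ1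
    have l2 : incr a y - γ ≤ γ ^ 2 / (1 - a 0) * (1 - y) := by
      have e : incr a y - γ = (quadRem a y - γ * contr a y) / contr a y := by
        unfold incr; field_simp
      rw [e]
      calc (quadRem a y - γ * contr a y) / contr a y ≤ (γ ^ 2 * (1 - y)) / contr a y := by
            refine div_le_div_of_nonneg_right ?_ hQ.le
            have : γ * contr a y = γ - γ * (1 - y) * quadRem a y := by unfold contr; ring
            rw [this]
            nlinarith [mul_le_mul_of_nonneg_left G1 (mul_nonneg hγ.le (sub_nonneg.2 hy1.le))]
        _ ≤ (γ ^ 2 * (1 - y)) / (1 - a 0) :=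
            div_le_div_of_nonneg_left (mul_nonneg (sq_nonneg _) (by linarith)) ha hQ2
        _ = _ := by ring
    have : 0 ≤ γ ^ 2 / (1 - a 0) * (1 - y) := mul_nonneg (by positivity) (by linarith)
    rw [abs_le]; constructor <;> simp only [hω] <;> linarith
  have hces := hωlim.cesaro
  rw [tendsto_iff_norm_sub_tendsto_zero]
  refine squeeze_zero' (Eventually.of_forall fun n => norm_nonneg _) ?_ hces
  filter_upwards [hx, eventually_gt_atTop 0] with n hn hn0
  have hn' : (0 : ℝ) < n := by exact_mod_cast hn0
  have e : incrSum a n (x n) / n - γ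
      = (n : ℝ)⁻¹ * ∑ m ∈ Finset.range n, (incr a (iter a m (x n)) - γ) := by
    rw [Finset.sum_sub_distrib]; simp only [incrSum, Finset.sum_const, Finset.card_range,
      nsmul_eq_mul]; field_simp
  rw [e, Real.norm_eq_abs, abs_mul, abs_of_pos (inv_pos.2 hn')]
  refine mul_le_mul_of_nonneg_left ((Finset.abs_sum_le_sum_abs _ _).trans
    (Finset.sum_le_sum fun m _ => ?_)) (by positivity)
  have hm := h.iter_mem hn.1 hn.2 m
  have hmono := h.iter_mono le_rfl hn.1 hn.2 m
  refine (hinc _ hm.1 hm.2).trans ?_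
  have := h.offspring.quadRem_mono (hmem m).1 hmono hm.2.le
  have h5 : γ ^ 2 / (1 - a 0) * (1 - iter a m (x n)) ≤ γ ^ 2 / (1 - a 0) * (1 - iter a m 0) :=
    mul_le_mul_of_nonneg_left (by linarith) (by positivity)
  simp only [hω]; linarith

end Critical

/-! ### Inverse moments and the difference quotient of a generating function at 0. -/

/-- The generating function of the shifted weights. -/
def tailGen (w : ℕ → ℝ) (s : ℝ) : ℝ := gen (fun k => w (k + 1)) s

/-- The inverse moment of order `q` over the positive integers. -/
def invMoment (w : ℕ → ℝ) (q : ℕ) : ℝ := ∑' k : ℕ, w (k + 1) / ((k : ℝ) + 1) ^ q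

section Weights

variable {w : ℕ → ℝ}

lemma summable_mul_pow (hw : ∀ k, 0 ≤ w k) (hs : Summable w) {x : ℝ} (hx : 0 ≤ x) (hx1 : x ≤ 1) :
    Summable fun k : ℕ => w k * x ^ k :=
  Summable.of_nonneg_of_le (fun j => mul_nonneg (hw j) (pow_nonneg hx j))
    (fun j => mul_le_of_le_one_right (hw j) (pow_le_one₀ hx hx1)) hs

lemma gen_eq_add_tailGen (hw : ∀ k, 0 ≤ w k) (hs : Summable w) {x : ℝ} (hx : 0 ≤ x) (hx1 : x ≤ 1) :
    gen w x = w 0 + x * tailGen w x := by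
  rw [gen, (summable_mul_pow hw hs hx hx1).tsum_eq_zero_add, tailGen, gen, ← tsum_mul_left]
  simp only [pow_zero, mul_one, pow_succ]
  congr 1; refine tsum_congr fun k => by ring

lemma tailGen_nonneg (hw : ∀ k, 0 ≤ w k) {x : ℝ} (hx : 0 ≤ x) : 0 ≤ tailGen w x :=
  tsum_nonneg fun k => mul_nonneg (hw _) (pow_nonneg hx k)

lemma tailGen_mono (hw : ∀ k, 0 ≤ w k) (hs : Summable w) {x y : ℝ} (hx : 0 ≤ x) (hxy : x ≤ y)
    (hy : y ≤ 1) : tailGen w x ≤ tailGen w y :=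
  (summable_mul_pow (fun k => hw (k + 1)) ((summable_nat_add_iff 1).2 hs) hx
    (hxy.trans hy)).tsum_le_tsum
    (fun j => mul_le_mul_of_nonneg_left (pow_le_pow_left₀ hx hxy j) (hw _))
    (summable_mul_pow (fun k => hw (k + 1)) ((summable_nat_add_iff 1).2 hs) (hx.trans hxy) hy)

/-- Dividing `gen w s` by `s` is useless near `0`. Moving up to `(1+s)/2 ≥ 1/2` costs a factor `2`
and only halves the distance to `1`. -/
lemma tailGen_le (hw : ∀ k, 0 ≤ w k) (hs : Summable w) {s : ℝ} (h0 : 0 ≤ s) (h1 : s ≤ 1) :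
    tailGen w s ≤ 2 * gen w ((1 + s) / 2) := by
  have hm := tailGen_mono hw hs h0 (show s ≤ (1 + s) / 2 by linarith) (by linarith)
  have he := gen_eq_add_tailGen hw hs (show 0 ≤ (1 + s) / 2 by linarith) (by linarith)
  have := tailGen_nonneg hw (show 0 ≤ (1 + s) / 2 by linarith)
  nlinarith [hw 0, mul_nonneg h0 this]

lemma continuousOn_tailGen (hw : ∀ k, 0 ≤ w k) (hs : Summable w) :
    ContinuousOn (tailGen w) (Set.Icc 0 1) := by
  refine continuousOn_tsum (fun k => by fun_prop) ((summable_nat_add_iff 1).2 hs) fun k x hx => ?_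
  rw [Real.norm_of_nonneg (mul_nonneg (hw _) (pow_nonneg hx.1 k))]
  exact mul_le_of_le_one_right (hw _) (pow_le_one₀ hx.1 hx.2)

lemma intervalIntegrable_tailGen (hw : ∀ k, 0 ≤ w k) (hs : Summable w) :
    IntervalIntegrable (tailGen w) volume 0 1 :=
  ContinuousOn.intervalIntegrable (by
    rw [Set.uIcc_of_le zero_le_one]; exact continuousOn_tailGen hw hs)

lemma summable_div_pow (hw : ∀ k, 0 ≤ w k) (hs : Summable w) (q : ℕ) :
    Summable fun k : ℕ => w (k + 1) / ((k : ℝ) + 1) ^ q := by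
  refine Summable.of_nonneg_of_le (fun k => div_nonneg (hw _) (by positivity)) (fun k => ?_)
    ((summable_nat_add_iff 1).2 hs)
  exact div_le_self (hw _) (one_le_pow₀ (by linarith [Nat.cast_nonneg (α := ℝ) k]))

lemma invMoment_nonneg (hw : ∀ k, 0 ≤ w k) (q : ℕ) : 0 ≤ invMoment w q :=
  tsum_nonneg fun _ => div_nonneg (hw _) (by positivity)

lemma integral_tailGen (hw : ∀ k, 0 ≤ w k) (hs : Summable w) :
    ∫ s in (0 : ℝ)..1, tailGen w s = invMoment w 1 := by
  have := intervalIntegral.hasSum_integral_of_dominated_convergence (μ := volume) (a := 0) (b := 1)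
    (F := fun (k : ℕ) (s : ℝ) => w (k + 1) * s ^ k) (f := tailGen w)
    (fun k _ => w (k + 1)) (fun k => by fun_prop) (fun k => ?_) ?_ ?_ ?_
  · rw [← this.tsum_eq]
    refine tsum_congr fun k => ?_
    rw [intervalIntegral.integral_const_mul, integral_pow]; simp [div_eq_mul_inv]
  · refine Eventually.of_forall fun s hm => ?_
    rw [Set.uIoc_of_le zero_le_one] at hm
    rw [Real.norm_of_nonneg (mul_nonneg (hw _) (pow_nonneg hm.1.le k))]
    exact mul_le_of_le_one_right (hw _) (pow_le_one₀ hm.1.le hm.2)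
  · exact Eventually.of_forall fun s _ => (summable_nat_add_iff 1).2 hs
  · exact intervalIntegrable_const
  · refine Eventually.of_forall fun s hm => ?_
    rw [Set.uIoc_of_le zero_le_one] at hm
    exact (summable_mul_pow (fun k => hw (k + 1)) ((summable_nat_add_iff 1).2 hs) hm.1.le
      hm.2).hasSum

/-- By monotonicity the integral over `[s, 1]` alone is at least the left side. It supplies the
positive lower bound for the limiting integral when `σ < 1`. -/
lemma mul_tailGen_le_invMoment (hw : ∀ k, 0 ≤ w k) (hs : Summable w) {s : ℝ} (h0 : 0 ≤ s)
    (h1 : s ≤ 1) : (1 - s) * tailGen w s ≤ invMoment w 1 := by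
  rw [← integral_tailGen hw hs]
  have hi := intervalIntegrable_tailGen hw hs
  have hi1 : IntervalIntegrable (tailGen w) volume 0 s :=
    hi.mono_set (by rw [Set.uIcc_of_le h0, Set.uIcc_of_le zero_le_one]; gcongr)
  have hi2 : IntervalIntegrable (tailGen w) volume s 1 :=
    hi.mono_set (by rw [Set.uIcc_of_le h1, Set.uIcc_of_le zero_le_one]; gcongr)
  rw [← intervalIntegral.integral_add_adjacent_intervals hi1 hi2]
  have e1 : 0 ≤ ∫ x in (0 : ℝ)..s, tailGen w x :=
    intervalIntegral.integral_nonneg h0 fun x hx => tailGen_nonneg hw hx.1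
  have e2 : ∫ _ in s..1, tailGen w s ≤ ∫ x in s..1, tailGen w x :=
    intervalIntegral.integral_mono_on h1 intervalIntegrable_const hi2 fun x hx =>
      tailGen_mono hw hs h0 hx.1 hx.2
  rw [intervalIntegral.integral_const, smul_eq_mul] at e2
  linarith

lemma invMoment_two_le (hw : ∀ k, 0 ≤ w k) (hs : Summable w) :
    invMoment w 2 ≤ invMoment w 1 := by
  refine (summable_div_pow hw hs 2).tsum_le_tsum (fun k => ?_) (summable_div_pow hw hs 1)
  have : (1 : ℝ) ≤ (k : ℝ) + 1 := by linarith [Nat.cast_nonneg (α := ℝ) k]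
  exact div_le_div_of_nonneg_left (hw _) (by positivity) (pow_le_pow_right₀ this (by norm_num))

/-- For an index `i ≥ N`, `1/i² ≤ 1/(N i)`; for `i ≤ N`, `1/i² ≤ 1 ≤ 2^N 2^{-i}`. So the second
inverse moment is negligible against the first once `gen w (1/2)` is. -/
lemma invMoment_two_le_add (hw : ∀ k, 0 ≤ w k) (hs : Summable w) {N : ℕ} (hN : 0 < N) :
    invMoment w 2 ≤ invMoment w 1 / N + 2 ^ N * gen w (1 / 2) := by
  have hh := summable_mul_pow hw hs (x := 1 / 2) (by norm_num) (by norm_num)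
  have hh1 := (summable_nat_add_iff 1).2 hh
  have e : ∑' k : ℕ, w (k + 1) * (1 / 2 : ℝ) ^ (k + 1) ≤ gen w (1 / 2) := by
    rw [gen, hh.tsum_eq_zero_add]
    have := hw 0; simp only [pow_zero, mul_one]; linarith
  calc invMoment w 2
      ≤ ∑' k : ℕ, (w (k + 1) / ((k : ℝ) + 1) ^ 1 / N
          + 2 ^ N * (w (k + 1) * (1 / 2 : ℝ) ^ (k + 1))) := by
        refine (summable_div_pow hw hs 2).tsum_le_tsum (fun k => ?_)
          (((summable_div_pow hw hs 1).div_const _).add (hh1.mul_left _))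
        have hk : (0 : ℝ) < (k : ℝ) + 1 := by positivity
        have hN' : (0 : ℝ) < N := by exact_mod_cast hN
        have hwk := hw (k + 1)
        rcases le_total N (k + 1) with hc | hc
        · have hc' : (N : ℝ) ≤ (k : ℝ) + 1 := by exact_mod_cast hc
          have : w (k + 1) / ((k : ℝ) + 1) ^ 2 ≤ w (k + 1) / ((k : ℝ) + 1) ^ 1 / N := by
            rw [div_div]
            refine div_le_div_of_nonneg_left hwk (by positivity) ?_
            nlinarith
          have : 0 ≤ 2 ^ N * (w (k + 1) * (1 / 2 : ℝ) ^ (k + 1)) := by positivity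
          linarith
        · have h1 : w (k + 1) / ((k : ℝ) + 1) ^ 2 ≤ w (k + 1) :=
            div_le_self hwk (one_le_pow₀ (by linarith [Nat.cast_nonneg (α := ℝ) k]))
          have h2 : (1 : ℝ) ≤ 2 ^ N * (1 / 2) ^ (k + 1) := by
            rw [div_pow, one_pow, mul_one_div, one_le_div (by positivity)]
            exact pow_le_pow_right₀ one_le_two hc
          have h3 : 0 ≤ w (k + 1) / ((k : ℝ) + 1) ^ 1 / N := by positivity
          have h4 := mul_le_mul_of_nonneg_left h2 hwk
          linarith
    _ = invMoment w 1 / N + 2 ^ N * ∑' k : ℕ, w (k + 1) * (1 / 2 : ℝ) ^ (k + 1) := by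
        rw [((summable_div_pow hw hs 1).div_const _).tsum_add (hh1.mul_left _), tsum_div_const,
          tsum_mul_left]
        rfl
    _ ≤ _ := by gcongr

lemma mul_pow_le_gen (hw : ∀ k, 0 ≤ w k) (hs : Summable w) {x : ℝ} (hx : 0 ≤ x) (hx1 : x ≤ 1)
    (k : ℕ) : w k * x ^ k ≤ gen w x :=
  (summable_mul_pow hw hs hx hx1).le_tsum k fun j _ => mul_nonneg (hw j) (pow_nonneg hx j)

end Weights

/-! ### Convergence of coefficients from generating functions, and model integrals. -/

lemma exists_tendsto_zero_coeff {p : ℕ → ℕ → ℝ} (hp : ∀ n k, 0 ≤ p n k) (hs : ∀ n, Summable (p n))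
    (hlim : ∀ x, 0 < x → x < 1 → ∃ l, Tendsto (fun n => gen (p n) x) atTop (𝓝 l)) :
    ∃ l, Tendsto (fun n => p n 0) atTop (𝓝 l) := by
  refine cauchySeq_tendsto_of_complete (Metric.cauchySeq_iff'.2 fun ε hε => ?_)
  obtain ⟨l, hl⟩ := hlim (1 / 2) (by norm_num) (by norm_num)
  obtain ⟨M, hM⟩ := hl.bddAbove_range
  have hM' : ∀ n, gen (p n) (1 / 2) ≤ M := fun n => hM ⟨n, rfl⟩
  have hM0 : 0 ≤ M := (tsum_nonneg fun k => mul_nonneg (hp 0 k) (by positivity)).trans (hM' 0)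
  obtain ⟨x, hx0, hx1, hxε⟩ : ∃ x : ℝ, 0 < x ∧ x ≤ 1 / 2 ∧ 2 * x * M < ε / 3 := by
    -- This gives `2xM ≤ ε/6`; using `M + 1` avoids division by zero.
    refine ⟨min (1 / 2) (ε / (12 * (M + 1))), by positivity, min_le_left _ _, ?_⟩
    have h1 : min (1 / 2) (ε / (12 * (M + 1))) * (M + 1) ≤ ε / 12 := by
      calc _ ≤ ε / (12 * (M + 1)) * (M + 1) := by gcongr; exact min_le_right _ _
        _ = ε / 12 := by field_simp
    have h2 : 0 < min (1 / 2) (ε / (12 * (M + 1))) := by positivity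
    nlinarith
  -- The value at a small `x` approximates the constant coefficient uniformly in `n`. Total masses
  -- may be unbounded in `n`, so the control comes from the value at `1/2`.
  have happ : ∀ n, 0 ≤ gen (p n) x - p n 0 ∧ gen (p n) x - p n 0 ≤ 2 * x * M := by
    intro n
    have e1 := gen_eq_add_tailGen (hp n) (hs n) hx0.le (by linarith)
    have e2 := gen_eq_add_tailGen (hp n) (hs n) (x := 1 / 2) (by norm_num) (by norm_num)
    have m := tailGen_mono (hp n) (hs n) hx0.le hx1 (by norm_num)
    have m0 := tailGen_nonneg (hp n) hx0.le
    have := hM' n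
    refine ⟨by rw [e1]; nlinarith, ?_⟩
    rw [e1]
    have : tailGen (p n) x ≤ 2 * M := by linarith [hp n 0]
    nlinarith
  obtain ⟨l', hl'⟩ := hlim x hx0 (by linarith)
  obtain ⟨N, hN⟩ := Metric.cauchySeq_iff'.1 hl'.cauchySeq (ε / 3) (by positivity)
  refine ⟨N, fun n hn => ?_⟩
  have h1 := hN n hn
  rw [Real.dist_eq, abs_lt] at h1 ⊢
  have h2 := happ n
  have h3 := happ N
  constructor <;> linarith

/-- Removing the constant coefficient and dividing by `x` shifts the sequence and preserves the
hypotheses. -/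
lemma exists_tendsto_coeff {p : ℕ → ℕ → ℝ} (hp : ∀ n k, 0 ≤ p n k) (hs : ∀ n, Summable (p n))
    (hlim : ∀ x, 0 < x → x < 1 → ∃ l, Tendsto (fun n => gen (p n) x) atTop (𝓝 l)) (k : ℕ) :
    ∃ l, Tendsto (fun n => p n k) atTop (𝓝 l) := by
  induction k generalizing p with
  | zero => exact exists_tendsto_zero_coeff hp hs hlim
  | succ k ih =>
    refine ih (p := fun n k => p n (k + 1)) (fun n k => hp n (k + 1))
      (fun n => (summable_nat_add_iff 1).2 (hs n)) fun x hx0 hx1 => ?_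
    obtain ⟨l, hl⟩ := hlim x hx0 hx1
    obtain ⟨l0, hl0⟩ := exists_tendsto_zero_coeff hp hs hlim
    refine ⟨(l - l0) / x, ((hl.sub hl0).div_const x).congr fun n => ?_⟩
    rw [gen_eq_add_tailGen (hp n) (hs n) hx0.le hx1.le, tailGen]
    field_simp; ring

lemma hasDerivAt_one_add_rpow {d σ t : ℝ} (hσ : σ ≠ 1) (hd : 0 < d) (ht : 0 < 1 + d * t) :
    HasDerivAt (fun t => -((1 + d * t) ^ (1 - σ) / (d * (σ - 1)))) ((1 + d * t) ^ (-σ)) t := by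
  have h1 : HasDerivAt (fun t => 1 + d * t) d t := by
    simpa using ((hasDerivAt_id t).const_mul d).const_add 1
  have h2 := ((h1.rpow_const (p := 1 - σ) (Or.inl ht.ne')).div_const (d * (σ - 1))).neg
  refine h2.congr_deriv ?_
  have : σ - 1 ≠ 0 := sub_ne_zero.2 hσ
  rw [show 1 - σ - 1 = -σ by ring]
  field_simp; ring

lemma tendsto_one_add_rpow {d σ : ℝ} (hσ : 1 < σ) (hd : 0 < d) :
    Tendsto (fun t => -((1 + d * t) ^ (1 - σ) / (d * (σ - 1)))) atTop (𝓝 0) := by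
  have h1 : Tendsto (fun t : ℝ => 1 + d * t) atTop atTop :=
    tendsto_atTop_add_const_left _ _ (tendsto_id.const_mul_atTop hd)
  have h2 := (tendsto_rpow_neg_atTop (y := σ - 1) (by linarith)).comp h1
  have := (h2.div_const (d * (σ - 1))).neg
  simp only [zero_div, neg_zero, neg_sub] at this
  exact this

lemma integrableOn_one_add_rpow {d σ : ℝ} (hσ : 1 < σ) (hd : 0 < d) :
    IntegrableOn (fun t => (1 + d * t) ^ (-σ)) (Set.Ioi 0) :=
  integrableOn_Ioi_deriv_of_nonneg' (fun t ht => hasDerivAt_one_add_rpow hσ.ne' hd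
      (by have : (0 : ℝ) ≤ t := ht; positivity))
    (fun t ht => by have : (0 : ℝ) < t := ht; positivity) (tendsto_one_add_rpow hσ hd)

lemma integral_one_add_rpow {d σ : ℝ} (hσ : 1 < σ) (hd : 0 < d) :
    ∫ t in Set.Ioi (0 : ℝ), (1 + d * t) ^ (-σ) = 1 / (d * (σ - 1)) := by
  rw [integral_Ioi_of_hasDerivAt_of_nonneg' (fun t ht => hasDerivAt_one_add_rpow hσ.ne' hd
      (by have : (0 : ℝ) ≤ t := ht; positivity))
    (fun t ht => by have : (0 : ℝ) < t := ht; positivity) (tendsto_one_add_rpow hσ hd)]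
  simp

lemma intervalIntegrable_one_add_inv {d : ℝ} (hd : 0 < d) :
    IntervalIntegrable (fun s => (1 + d * (1 - s))⁻¹) volume 0 1 := by
  refine ContinuousOn.intervalIntegrable (ContinuousOn.inv₀ (by fun_prop) fun s hs => ?_)
  rw [Set.uIcc_of_le zero_le_one] at hs
  have := mul_nonneg hd.le (sub_nonneg.2 hs.2)
  linarith

lemma integral_one_add_inv {d : ℝ} (hd : 0 < d) :
    ∫ s in (0 : ℝ)..1, (1 + d * (1 - s))⁻¹ = Real.log (1 + d) / d := by
  have := intervalIntegral.integral_eq_sub_of_hasDerivAt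
    (f := fun s => -(Real.log (1 + d * (1 - s)) / d)) (f' := fun s => (1 + d * (1 - s))⁻¹)
    (a := 0) (b := 1) (fun s hs => ?_) (intervalIntegrable_one_add_inv hd)
  · rw [this]; simp
  · rw [Set.uIcc_of_le zero_le_one] at hs
    have h0 := mul_nonneg hd.le (sub_nonneg.2 hs.2)
    have h1 : HasDerivAt (fun s => 1 + d * (1 - s)) (-d) s := by
      simpa using (((hasDerivAt_id s).const_sub 1).const_mul d).const_add 1
    refine ((h1.log (by linarith)).div_const d).neg.congr_deriv ?_
    have : 1 + d * (1 - s) ≠ 0 := by linarith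
    field_simp

/-! ### Asymptotics and uniform bounds for `H_n`. -/

/-- `p n` is the law of the `n`-th generation, expressed through its generating function. -/
structure IsLaw (p : ℕ → ℕ → ℝ) (a b : ℕ → ℝ) : Prop where
  nonneg : ∀ n k, 0 ≤ p n k
  total : ∀ n, HasSum (p n) 1
  gen_eq : ∀ n x, 0 ≤ x → x ≤ 1 → gen (p n) x = genZ a b n x

namespace Critical

variable {a b : ℕ → ℝ} {β γ ρ : ℝ} {p : ℕ → ℕ → ℝ}

/-- In the product formula the exponential factor is bounded above and below, and `incrSum` lies
between `a 0 * n` and `γ / (1 - a 0) * n`. -/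
lemma genZ_bounds (h : Critical a b β γ ρ) :
    ∃ M, 0 < M ∧ ∀ x, 0 ≤ x → x < 1 → ∀ n : ℕ,
      genZ a b n x ≤ M * (1 + a 0 * n * (1 - x)) ^ (-(β / γ)) ∧
      M⁻¹ * (1 + γ / (1 - a 0) * n * (1 - x)) ^ (-(β / γ)) ≤ genZ a b n x := by
  obtain ⟨K, hK⟩ := h.abs_logErrSum_le
  have ha := h.a_pos
  have hσ : 0 < β / γ := div_pos h.β_pos h.γ_pos
  refine ⟨Real.exp K, Real.exp_pos K, fun x hx hx1 n => ?_⟩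
  have hR := h.one_add_pos hx hx1 n
  have hx' := sub_nonneg.2 hx1.le
  have h1 := mul_le_mul_of_nonneg_right (h.le_incrSum hx hx1 n) hx'
  have h2 := mul_le_mul_of_nonneg_right (h.incrSum_le hx hx1 n) hx'
  have h3 := abs_le.1 (hK x hx hx1 n)
  rw [h.genZ_eq (β / γ) hx hx1 n]
  constructor
  · refine mul_le_mul (Real.exp_le_exp.2 h3.2) ?_ (by positivity) (Real.exp_pos K).le
    refine Real.rpow_le_rpow_of_nonpos (by positivity) ?_ (by linarith)
    linarith
  · rw [← Real.exp_neg]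
    refine mul_le_mul (Real.exp_le_exp.2 h3.1) ?_ ?_ (Real.exp_pos _).le
    · exact Real.rpow_le_rpow_of_nonpos hR (by linarith) (by linarith)
    · have : 0 ≤ γ / (1 - a 0) := div_nonneg h.γ_pos.le (by linarith [h.a_lt])
      positivity

/-- The limit of `n ^ σ H_n(x)`. -/
def limitGen (a b : ℕ → ℝ) (β γ x : ℝ) : ℝ :=
  Real.exp (∑' m, logErr a b (β / γ) (iter a m x)) * (γ * (1 - x)) ^ (-(β / γ))

lemma tendsto_rpow_mul_genZ (h : Critical a b β γ ρ) {x : ℝ} (hx : 0 ≤ x) (hx1 : x < 1) :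
    Tendsto (fun n : ℕ => (n : ℝ) ^ (β / γ) * genZ a b n x) atTop (𝓝 (limitGen a b β γ x)) := by
  have hx' := sub_pos.2 hx1
  have h1 := (Real.continuous_exp.tendsto _).comp (h.tendsto_logErrSum hx hx1)
  have h2 : Tendsto (fun n : ℕ => 1 / (n : ℝ) + (1 - x) * (incrSum a n x / n)) atTop
      (𝓝 (γ * (1 - x))) := by
    have := tendsto_one_div_atTop_nhds_zero_nat (𝕜 := ℝ)
    have h3 := this.add ((h.tendsto_incrSum_div (x := fun _ => x)
      (Eventually.of_forall fun _ => ⟨hx, hx1⟩)).const_mul (1 - x))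
    rwa [zero_add, mul_comm] at h3
  have h4 := h1.mul (h2.rpow_const (p := -(β / γ)) (Or.inl (mul_pos h.γ_pos hx').ne'))
  refine h4.congr' ?_
  filter_upwards [eventually_gt_atTop 0] with n hn
  have hn' : (0 : ℝ) < n := by exact_mod_cast hn
  have hR := h.one_add_pos hx hx1 n
  rw [h.genZ_eq (β / γ) hx hx1 n, Function.comp_apply,
    show 1 / (n : ℝ) + (1 - x) * (incrSum a n x / n) = (1 + (1 - x) * incrSum a n x) / n by
      field_simp, Real.div_rpow hR.le hn'.le, Real.rpow_neg hn'.le]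
  field_simp

/-- The limit is the Laplace transform of the gamma law with shape `σ` and scale `γ`, the limit law
of `Z_n / n`. -/
lemma tendsto_genZ_comp (h : Critical a b β γ ρ) {t : ℝ} (ht : 0 < t) :
    Tendsto (fun n : ℕ => genZ a b n (1 - t / n)) atTop (𝓝 ((1 + γ * t) ^ (-(β / γ)))) := by
  have hlim : Tendsto (fun n : ℕ => 1 - t / (n : ℝ)) atTop (𝓝 1) := by
    simpa using (tendsto_const_nhds (x := (1 : ℝ))).sub (tendsto_const_div_atTop_nhds_zero_nat t)
  have hx : ∀ᶠ n : ℕ in atTop, 0 ≤ 1 - t / (n : ℝ) ∧ 1 - t / (n : ℝ) < 1 := by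
    filter_upwards [eventually_ge_atTop ⌈t⌉₊, eventually_gt_atTop 0] with n hn hn0
    have hn' : (0 : ℝ) < n := by exact_mod_cast hn0
    have : t ≤ n := Nat.ceil_le.1 hn
    have h1 : t / n ≤ 1 := (div_le_one hn').2 this
    have h2 : 0 < t / n := by positivity
    constructor <;> linarith
  have h1 := (Real.continuous_exp.tendsto _).comp (h.tendsto_logErrSum_zero hx hlim)
  have h2 := ((h.tendsto_incrSum_div hx).mul_const t).const_add 1
  have hpos : 0 < 1 + γ * t := by have := h.γ_pos; positivity
  have h3 := h1.mul (h2.rpow_const (p := -(β / γ)) (Or.inl hpos.ne'))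
  rw [Real.exp_zero, one_mul] at h3
  refine h3.congr' ?_
  filter_upwards [hx, eventually_gt_atTop 0] with n hn hn0
  have hn' : (0 : ℝ) < n := by exact_mod_cast hn0
  rw [h.genZ_eq (β / γ) hn.1 hn.2 n, Function.comp_apply]
  congr 3
  field_simp
  ring

/-- The limit function is at least `e^{-K}(γ(1-s))^{-σ}`, hence unbounded as `s → 1`. -/
lemma exists_limitGen_gt (h : Critical a b β γ ρ) :
    ∃ s, 0 < s ∧ s < 1 ∧ limitGen a b β γ 0 < limitGen a b β γ s := by
  obtain ⟨K, hK⟩ := h.abs_logErrSum_le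
  have hγ := h.γ_pos
  have hσ : 0 < β / γ := div_pos h.β_pos h.γ_pos
  have h1 : Tendsto (fun s : ℝ => γ * (1 - s)) (𝓝[<] 1) (𝓝[>] 0) := by
    refine tendsto_nhdsWithin_iff.2 ⟨?_, ?_⟩
    · have : Tendsto (fun s : ℝ => γ * (1 - s)) (𝓝 1) (𝓝 (γ * (1 - 1))) :=
        Continuous.tendsto (by fun_prop) 1
      rw [sub_self, mul_zero] at this
      exact this.mono_left nhdsWithin_le_nhds
    · filter_upwards [self_mem_nhdsWithin] with s hs
      exact mul_pos hγ (sub_pos.2 hs)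
  have h2 := ((tendsto_rpow_neg_nhdsGT_zero (y := -(β / γ)) (by linarith)).comp h1).const_mul_atTop
    (Real.exp_pos (-K))
  obtain ⟨s, ⟨hs1, hs2⟩, hs0⟩ := ((h2.eventually_gt_atTop (limitGen a b β γ 0)).and
    self_mem_nhdsWithin |>.and (Ioo_mem_nhdsLT zero_lt_one)).exists
  refine ⟨s, hs0.1, hs0.2, hs1.trans_le ?_⟩
  refine mul_le_mul_of_nonneg_right (Real.exp_le_exp.2 ?_)
    (Real.rpow_nonneg (mul_nonneg hγ.le (by linarith [hs0.2])) _)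
  exact ge_of_tendsto' (h.tendsto_logErrSum hs0.1.le hs0.2) fun n =>
    (abs_le.1 (hK s hs0.1.le hs0.2 n)).1

lemma tailGen_bound (h : Critical a b β γ ρ) (hp : IsLaw p a b) :
    ∃ M, 0 < M ∧ ∀ s, 0 ≤ s → s < 1 → ∀ n : ℕ,
      tailGen (p n) s ≤ M * (1 + a 0 / 2 * n * (1 - s)) ^ (-(β / γ)) := by
  obtain ⟨M, hM, hb⟩ := h.genZ_bounds
  refine ⟨2 * M, by positivity, fun s hs hs1 n => ?_⟩
  have h1 := tailGen_le (hp.nonneg n) (hp.total n).summable hs hs1.le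
  rw [hp.gen_eq n _ (by linarith) (by linarith)] at h1
  have h2 := (hb ((1 + s) / 2) (by linarith) (by linarith) n).1
  rw [show 1 + a 0 * n * (1 - (1 + s) / 2) = 1 + a 0 / 2 * n * (1 - s) by ring] at h2
  linarith

lemma law_zero (hp : IsLaw p a b) (n : ℕ) : p n 0 = genZ a b n 0 := by
  rw [← hp.gen_eq n 0 le_rfl zero_le_one, HasMoments.gen_zero]

lemma tendsto_law_zero (h : Critical a b β γ ρ) (hp : IsLaw p a b) :
    Tendsto (fun n => p n 0) atTop (𝓝 0) := by
  obtain ⟨M, hM, hb⟩ := h.genZ_bounds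
  have hσ : 0 < β / γ := div_pos h.β_pos h.γ_pos
  have h1 : Tendsto (fun n : ℕ => 1 + a 0 * (n : ℝ) * (1 - 0)) atTop atTop := by
    simp only [sub_zero, mul_one]
    exact tendsto_atTop_add_const_left _ _
      (tendsto_natCast_atTop_atTop.const_mul_atTop h.a_pos)
  have h2 := ((tendsto_rpow_neg_atTop hσ).comp h1).const_mul M
  rw [mul_zero] at h2
  refine squeeze_zero (fun n => hp.nonneg n 0) (fun n => ?_) h2
  rw [law_zero hp]
  exact (hb 0 le_rfl zero_lt_one n).1

lemma rpow_mul_le (h : Critical a b β γ ρ) {c y : ℝ} (hc : 0 < c) (hy : 0 < y) {n : ℕ}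
    (hn : 0 < n) : (n : ℝ) ^ (β / γ) * (1 + c * n * y) ^ (-(β / γ)) ≤ (c * y) ^ (-(β / γ)) := by
  have hσ : 0 < β / γ := div_pos h.β_pos h.γ_pos
  have hn' : (0 : ℝ) < n := by exact_mod_cast hn
  calc (n : ℝ) ^ (β / γ) * (1 + c * n * y) ^ (-(β / γ))
      ≤ (n : ℝ) ^ (β / γ) * (n * (c * y)) ^ (-(β / γ)) := by
        refine mul_le_mul_of_nonneg_left (Real.rpow_le_rpow_of_nonpos (by positivity) ?_
          (by linarith)) (by positivity)
        linarith [show c * n * y = n * (c * y) by ring]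
    _ = _ := by
        rw [Real.mul_rpow hn'.le (by positivity), ← mul_assoc, ← Real.rpow_add hn', add_neg_cancel,
          Real.rpow_zero, one_mul]

/-! ### Inverse moments for `σ < 1`. -/

section Subcritical

/-- The integrands `n^σ * tailGen (p n) s` are dominated by a multiple of `(1-s)^{-σ}`, integrable
exactly because `σ < 1`; the same majorant makes the limit integrable. -/
lemma invMoment_one_asymp (h : Critical a b β γ ρ) (hp : IsLaw p a b) (hσ1 : β / γ < 1) :
    IntervalIntegrable (fun s => (limitGen a b β γ s - limitGen a b β γ 0) / s) volume 0 1 ∧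
    Tendsto (fun n : ℕ => (n : ℝ) ^ (β / γ) * invMoment (p n) 1) atTop
      (𝓝 (∫ s in (0 : ℝ)..1, (limitGen a b β γ s - limitGen a b β γ 0) / s)) := by
  obtain ⟨M, hM, hb⟩ := h.tailGen_bound hp
  have ha := h.a_pos
  have hlim : ∀ s : ℝ, 0 < s → s < 1 → Tendsto (fun n : ℕ => (n : ℝ) ^ (β / γ) * tailGen (p n) s)
      atTop (𝓝 ((limitGen a b β γ s - limitGen a b β γ 0) / s)) := by
    intro s hs hs1
    refine (((h.tendsto_rpow_mul_genZ hs.le hs1).sub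
      (h.tendsto_rpow_mul_genZ le_rfl zero_lt_one)).div_const s).congr fun n => ?_
    have := gen_eq_add_tailGen (hp.nonneg n) (hp.total n).summable hs.le hs1.le
    rw [hp.gen_eq n s hs.le hs1.le, law_zero hp] at this
    rw [this]; field_simp; ring
  set g : ℝ → ℝ := fun s => M * (a 0 / 2) ^ (-(β / γ)) * (1 - s) ^ (-(β / γ)) with hg
  have hgi : IntervalIntegrable g volume 0 1 := by
    have h1 : IntervalIntegrable (fun s : ℝ => s ^ (-(β / γ))) volume 0 1 :=
      intervalIntegral.intervalIntegrable_rpow' (by linarith)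
    have h2 := (h1.comp_sub_left 1).symm
    simp only [sub_zero, sub_self] at h2
    exact h2.const_mul _
  have hbd : ∀ n : ℕ, 0 < n → ∀ s : ℝ, 0 < s → s < 1 →
      ‖(n : ℝ) ^ (β / γ) * tailGen (p n) s‖ ≤ g s := by
    intro n hn s hs hs1
    have hs' := sub_pos.2 hs1
    rw [Real.norm_of_nonneg (mul_nonneg (by positivity) (tailGen_nonneg (hp.nonneg n) hs.le))]
    have h1 := h.rpow_mul_le (c := a 0 / 2) (by positivity) hs' hn
    have h2 := mul_le_mul_of_nonneg_left (hb s hs.le hs1 n)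
      (by positivity : (0 : ℝ) ≤ (n : ℝ) ^ (β / γ))
    rw [Real.mul_rpow (by positivity) hs'.le] at h1
    have h3 := mul_le_mul_of_nonneg_left h1 hM.le
    simp only [hg]
    linarith
  have hae : ∀ {q : ℝ → Prop}, (∀ s, 0 < s → s < 1 → q s) →
      ∀ᵐ s ∂volume, s ∈ Set.uIoc (0 : ℝ) 1 → q s := by
    intro q hq
    rw [Set.uIoc_of_le zero_le_one]
    filter_upwards [Measure.ae_ne volume (1 : ℝ)] with s hs1 hs
    exact hq s hs.1 (lt_of_le_of_ne hs.2 hs1)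
  have hmeas : ∀ n : ℕ, AEStronglyMeasurable (fun s => (n : ℝ) ^ (β / γ) * tailGen (p n) s)
      (volume.restrict (Set.uIoc 0 1)) := fun n => by
    rw [Set.uIoc_of_le zero_le_one]
    exact ((intervalIntegrable_tailGen (hp.nonneg n) (hp.total n).summable).const_mul
      _).aestronglyMeasurable
  constructor
  · rw [intervalIntegrable_iff] at hgi ⊢
    refine Integrable.mono' hgi (aestronglyMeasurable_of_tendsto_ae atTop hmeas ?_) ?_
    · exact (ae_restrict_iff' measurableSet_uIoc).2 (hae hlim)
    · refine (ae_restrict_iff' measurableSet_uIoc).2 (hae fun s hs hs1 => ?_)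
      refine le_of_tendsto (hlim s hs hs1).norm ?_
      filter_upwards [eventually_gt_atTop 0] with n hn using hbd n hn s hs hs1
  · have := intervalIntegral.tendsto_integral_filter_of_dominated_convergence g
      (Eventually.of_forall hmeas) (l := atTop)
      (by filter_upwards [eventually_gt_atTop 0] with n hn using hae (hbd n hn)) hgi (hae hlim)
    refine this.congr fun n => ?_
    rw [intervalIntegral.integral_const_mul, integral_tailGen (hp.nonneg n) (hp.total n).summable]

/-- The bound `(1-s) * tailGen ≤ e₁` passes to the limit at a point `s` with `U(s) > U(0)`. -/
lemma integral_limitGen_pos (h : Critical a b β γ ρ) (hp : IsLaw p a b) (hσ1 : β / γ < 1) :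
    0 < ∫ s in (0 : ℝ)..1, (limitGen a b β γ s - limitGen a b β γ 0) / s := by
  obtain ⟨s, hs0, hs1, hs⟩ := h.exists_limitGen_gt
  have h1 := (h.invMoment_one_asymp hp hσ1).2
  have h2 := (((h.tendsto_rpow_mul_genZ hs0.le hs1).sub
      (h.tendsto_rpow_mul_genZ le_rfl zero_lt_one)).div_const s).const_mul (1 - s)
  refine lt_of_lt_of_le ?_ (le_of_tendsto_of_tendsto' h2 h1 fun n => ?_)
  · exact mul_pos (sub_pos.2 hs1) (div_pos (sub_pos.2 hs) hs0)
  · have := gen_eq_add_tailGen (hp.nonneg n) (hp.total n).summable hs0.le hs1.le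
    rw [hp.gen_eq n s hs0.le hs1.le, law_zero hp] at this
    have e := mul_le_mul_of_nonneg_left (mul_tailGen_le_invMoment (hp.nonneg n)
      (hp.total n).summable hs0.le hs1.le) (by positivity : (0 : ℝ) ≤ (n : ℝ) ^ (β / γ))
    refine le_trans (le_of_eq ?_) e
    rw [this]; field_simp; ring

lemma exists_tendsto_law (h : Critical a b β γ ρ) (hp : IsLaw p a b) (k : ℕ) :
    ∃ l, Tendsto (fun n : ℕ => (n : ℝ) ^ (β / γ) * p n k) atTop (𝓝 l) := by
  refine exists_tendsto_coeff (p := fun n k => (n : ℝ) ^ (β / γ) * p n k)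
    (fun n k => mul_nonneg (by positivity) (hp.nonneg n k))
    (fun n => (hp.total n).summable.mul_left _) (fun x hx hx1 => ?_) k
  refine ⟨_, (h.tendsto_rpow_mul_genZ hx.le hx1).congr fun n => ?_⟩
  rw [← hp.gen_eq n x hx.le hx1.le, gen, gen, ← tsum_mul_left]
  simp only [mul_assoc]

/-- A Chernoff-type bound at `x = 1 - 1/(k+2)`, where `x^(k+1) ≥ 1/e`: the mass at `k+1` is at most
`e H_n(x)`, and `n^σ H_n(x)` is at most a multiple of `(k+2)^σ ≤ (2(k+1))^σ`. -/
lemma rpow_mul_law_le (h : Critical a b β γ ρ) (hp : IsLaw p a b) :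
    ∃ C, ∀ n : ℕ, 0 < n → ∀ k : ℕ,
      (n : ℝ) ^ (β / γ) * p n (k + 1) ≤ C * ((k : ℝ) + 1) ^ (β / γ) := by
  obtain ⟨M, hM, hb⟩ := h.genZ_bounds
  have ha := h.a_pos
  have hσ : 0 < β / γ := div_pos h.β_pos h.γ_pos
  refine ⟨Real.exp 1 * M * (a 0 / 2) ^ (-(β / γ)), fun n hn k => ?_⟩
  set x : ℝ := ((k : ℝ) + 1) / ((k : ℝ) + 2) with hxdef
  have hx0 : 0 < x := by positivity
  have hx1' : 1 - x = 1 / ((k : ℝ) + 2) := by rw [hxdef]; field_simp; ring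
  have hx1 : x < 1 := by
    have : 0 < 1 - x := by rw [hx1']; positivity
    linarith
  have h1 : 1 ≤ Real.exp 1 * x ^ (k + 1) := by
    have e1 : 1 / ((k : ℝ) + 1) + 1 = x⁻¹ := by rw [hxdef]; field_simp; ring
    have e2 := pow_le_pow_left₀ (by positivity) (Real.add_one_le_exp (1 / ((k : ℝ) + 1))) (k + 1)
    rw [e1, ← Real.exp_nat_mul, inv_pow, inv_le_iff_one_le_mul₀ (by positivity)] at e2
    refine e2.trans (le_of_eq ?_)
    congr 2; push_cast; field_simp
  have h2 := mul_pow_le_gen (hp.nonneg n) (hp.total n).summable hx0.le hx1.le (k + 1)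
  rw [hp.gen_eq n x hx0.le hx1.le] at h2
  have h3 := h2.trans (hb x hx0.le hx1 n).1
  have h4 := h.rpow_mul_le ha (sub_pos.2 hx1) hn
  have h5 : (a 0 * (1 - x)) ^ (-(β / γ)) ≤ (a 0 / 2) ^ (-(β / γ)) * ((k : ℝ) + 1) ^ (β / γ) := by
    have : ((k : ℝ) + 1) ^ (β / γ) = (((k : ℝ) + 1)⁻¹) ^ (-(β / γ)) := by
      rw [Real.rpow_neg (by positivity), Real.inv_rpow (by positivity), inv_inv]
    rw [this, ← Real.mul_rpow (by positivity) (by positivity), hx1']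
    refine Real.rpow_le_rpow_of_nonpos (by positivity) ?_ (by linarith)
    rw [div_mul_eq_mul_div, ← div_eq_mul_inv, mul_one_div, div_div]
    exact div_le_div_of_nonneg_left ha.le (by positivity) (by linarith [Nat.cast_nonneg (α := ℝ) k])
  have hnσ : (0 : ℝ) ≤ (n : ℝ) ^ (β / γ) := by positivity
  calc (n : ℝ) ^ (β / γ) * p n (k + 1)
      ≤ (n : ℝ) ^ (β / γ) * p n (k + 1) * (Real.exp 1 * x ^ (k + 1)) :=
        le_mul_of_one_le_right (mul_nonneg hnσ (hp.nonneg _ _)) h1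
    _ = Real.exp 1 * ((n : ℝ) ^ (β / γ) * (p n (k + 1) * x ^ (k + 1))) := by ring
    _ ≤ Real.exp 1 * ((n : ℝ) ^ (β / γ) * (M * (1 + a 0 * n * (1 - x)) ^ (-(β / γ)))) := by gcongr
    _ = Real.exp 1 * M * ((n : ℝ) ^ (β / γ) * (1 + a 0 * n * (1 - x)) ^ (-(β / γ))) := by ring
    _ ≤ Real.exp 1 * M * ((a 0 / 2) ^ (-(β / γ)) * ((k : ℝ) + 1) ^ (β / γ)) := by
        exact mul_le_mul_of_nonneg_left (h4.trans h5) (by positivity)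
    _ = _ := by ring

/-- Dominated convergence of series with majorant `(k+1)^{σ-2}`, summable since `σ < 1`. -/
lemma invMoment_two_asymp (h : Critical a b β γ ρ) (hp : IsLaw p a b) (hσ1 : β / γ < 1)
    {μ : ℕ → ℝ}
    (hμ : ∀ k, Tendsto (fun n : ℕ => (n : ℝ) ^ (β / γ) * p n k) atTop (𝓝 (μ k))) :
    Summable (fun k : ℕ => μ (k + 1) / ((k : ℝ) + 1) ^ 2) ∧
    Tendsto (fun n : ℕ => (n : ℝ) ^ (β / γ) * invMoment (p n) 2) atTop
      (𝓝 (∑' k : ℕ, μ (k + 1) / ((k : ℝ) + 1) ^ 2)) := by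
  obtain ⟨C, hC⟩ := h.rpow_mul_law_le hp
  have hs : Summable fun k : ℕ => C * ((k : ℝ) + 1) ^ (β / γ - 2) := by
    have := (summable_nat_add_iff 1).2 (Real.summable_nat_rpow.2 (by linarith : β / γ - 2 < -1))
    exact (this.congr fun k => by push_cast; rfl).mul_left C
  have hbd : ∀ n : ℕ, 0 < n → ∀ k : ℕ,
      (n : ℝ) ^ (β / γ) * p n (k + 1) / ((k : ℝ) + 1) ^ 2 ≤ C * ((k : ℝ) + 1) ^ (β / γ - 2) := by
    intro n hn k
    rw [Real.rpow_sub (by positivity), Real.rpow_two, ← mul_div_assoc]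
    exact div_le_div_of_nonneg_right (hC n hn k) (by positivity)
  have hnn : ∀ n k : ℕ, 0 ≤ (n : ℝ) ^ (β / γ) * p n (k + 1) / ((k : ℝ) + 1) ^ 2 := fun n k =>
    div_nonneg (mul_nonneg (by positivity) (hp.nonneg _ _)) (by positivity)
  have hl : ∀ k : ℕ, Tendsto (fun n : ℕ => (n : ℝ) ^ (β / γ) * p n (k + 1) / ((k : ℝ) + 1) ^ 2)
      atTop (𝓝 (μ (k + 1) / ((k : ℝ) + 1) ^ 2)) := fun k => (hμ (k + 1)).div_const _
  constructor
  · refine Summable.of_nonneg_of_le (fun k => ge_of_tendsto' (hl k) fun n => hnn n k)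
      (fun k => le_of_tendsto (hl k) ?_) hs
    filter_upwards [eventually_gt_atTop 0] with n hn using hbd n hn k
  · refine (tendsto_tsum_of_dominated_convergence hs hl ?_).congr fun n => ?_
    · filter_upwards [eventually_gt_atTop 0] with n hn k
      rw [Real.norm_of_nonneg (hnn n k)]; exact hbd n hn k
    · rw [invMoment, ← tsum_mul_left]
      simp only [mul_div_assoc]

end Subcritical

/-! ### Inverse moments for `σ > 1`. -/

section Supercritical

/-- Substituting `s = 1 - t/n` turns `n e₁` into an integral over `(0, n]`, extended by an indicator
to the half-line. The integrand tends to `(1+γt)^{-σ}` and is dominated by a multiple of `(1 + (a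
0)t/2)^{-σ}`, integrable since `σ > 1`. -/
lemma mul_invMoment_one_tendsto (h : Critical a b β γ ρ) (hp : IsLaw p a b) (hσ1 : 1 < β / γ) :
    Tendsto (fun n : ℕ => (n : ℝ) * invMoment (p n) 1) atTop (𝓝 (1 / (β - γ))) := by
  obtain ⟨M, hM, hb⟩ := h.tailGen_bound hp
  have ha := h.a_pos
  have hγ := h.γ_pos
  have e : 1 / (β - γ) = ∫ t in Set.Ioi (0 : ℝ), (1 + γ * t) ^ (-(β / γ)) := by
    rw [integral_one_add_rpow hσ1 hγ]; congr 1; field_simp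
  rw [e]
  have key : Tendsto (fun n : ℕ => ∫ t in Set.Ioi (0 : ℝ),
      (Set.Iic (n : ℝ)).indicator (fun t => tailGen (p n) (1 - t / n)) t) atTop
      (𝓝 (∫ t in Set.Ioi (0 : ℝ), (1 + γ * t) ^ (-(β / γ)))) := by
    refine tendsto_integral_filter_of_dominated_convergence
      (fun t => M * (1 + a 0 / 2 * t) ^ (-(β / γ))) ?_ ?_
      ((integrableOn_one_add_rpow hσ1 (by positivity)).const_mul M) ?_
    · filter_upwards [eventually_gt_atTop 0] with n hn
      have hn' : (0 : ℝ) < n := by exact_mod_cast hn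
      rw [aestronglyMeasurable_indicator_iff measurableSet_Iic, Measure.restrict_restrict
        measurableSet_Iic, Set.inter_comm, Set.Ioi_inter_Iic]
      refine ContinuousOn.aestronglyMeasurable ?_ measurableSet_Ioc
      refine (continuousOn_tailGen (hp.nonneg n) (hp.total n).summable).comp (by fun_prop)
        fun t ht => ?_
      have h1 : t / n ≤ 1 := (div_le_one hn').2 ht.2
      have h2 : 0 < t / n := div_pos ht.1 hn'
      constructor <;> linarith
    · filter_upwards [eventually_gt_atTop 0] with n hn
      have hn' : (0 : ℝ) < n := by exact_mod_cast hn
      refine (ae_restrict_iff' measurableSet_Ioi).2 (Eventually.of_forall fun t ht => ?_)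
      have ht0 : (0 : ℝ) < t := ht
      by_cases htn : t ∈ Set.Iic (n : ℝ)
      · rw [Set.indicator_of_mem htn]
        have h1 : t / n ≤ 1 := (div_le_one hn').2 htn
        have h2 : 0 < t / n := div_pos ht0 hn'
        rw [Real.norm_of_nonneg (tailGen_nonneg (hp.nonneg n) (by linarith))]
        refine (hb (1 - t / n) (by linarith) (by linarith) n).trans (le_of_eq ?_)
        congr 3; field_simp; ring
      · rw [Set.indicator_of_notMem htn, norm_zero]; positivity
    · refine (ae_restrict_iff' measurableSet_Ioi).2 (Eventually.of_forall fun t ht => ?_)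
      have ht0 : (0 : ℝ) < t := ht
      have hlim : Tendsto (fun n : ℕ => 1 - t / (n : ℝ)) atTop (𝓝 1) := by
        simpa using (tendsto_const_nhds (x := (1 : ℝ))).sub
          (tendsto_const_div_atTop_nhds_zero_nat t)
      have h1 := ((h.tendsto_genZ_comp ht0).sub (h.tendsto_law_zero hp)).div hlim one_ne_zero
      rw [sub_zero, div_one] at h1
      refine h1.congr' ?_
      filter_upwards [eventually_gt_atTop ⌈t⌉₊] with n hn
      have htn : t < n := lt_of_le_of_lt (Nat.le_ceil t) (by exact_mod_cast hn)
      have hn' : (0 : ℝ) < n := ht0.trans htn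
      have h1 : t / n < 1 := (div_lt_one hn').2 htn
      have h2 : 0 < t / n := div_pos ht0 hn'
      rw [Set.indicator_of_mem (show t ∈ Set.Iic (n : ℝ) from htn.le), Pi.div_apply,
        ← hp.gen_eq n _ (by linarith) (by linarith),
        gen_eq_add_tailGen (hp.nonneg n) (hp.total n).summable (by linarith) (by linarith)]
      have : 1 - t / n ≠ 0 := by linarith
      rw [add_sub_cancel_left, mul_div_cancel_left₀ _ this]
  refine key.congr' ?_
  filter_upwards [eventually_gt_atTop 0] with n hn
  have hn' : (0 : ℝ) < n := by exact_mod_cast hn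
  rw [setIntegral_indicator measurableSet_Iic, Set.Ioi_inter_Iic,
    ← intervalIntegral.integral_of_le hn'.le,
    intervalIntegral.integral_comp_div (fun t => tailGen (p n) (1 - t)) hn'.ne', zero_div,
    div_self hn'.ne', intervalIntegral.integral_comp_sub_left (tailGen (p n)), sub_self, sub_zero,
    integral_tailGen (hp.nonneg n) (hp.total n).summable, smul_eq_mul]

/-- Here `n H_n(1/2)` is of order `n^{1-σ}`, so any fixed number of small values of `Z_n`
contributes nothing, while the rest is at most `n e₁ / N`. -/
lemma mul_invMoment_two_tendsto (h : Critical a b β γ ρ) (hp : IsLaw p a b) (hσ1 : 1 < β / γ) :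
    Tendsto (fun n : ℕ => (n : ℝ) * invMoment (p n) 2) atTop (𝓝 0) := by
  have h1 := h.mul_invMoment_one_tendsto hp hσ1
  have h2 : Tendsto (fun n : ℕ => (n : ℝ) * gen (p n) (1 / 2)) atTop (𝓝 0) := by
    have e1 := h.tendsto_rpow_mul_genZ (x := 1 / 2) (by norm_num) (by norm_num)
    have e2 := ((tendsto_rpow_neg_atTop (y := β / γ - 1) (by linarith)).comp
      tendsto_natCast_atTop_atTop).mul e1
    rw [zero_mul] at e2
    refine e2.congr' ?_
    filter_upwards [eventually_gt_atTop 0] with n hn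
    have hn' : (0 : ℝ) < n := by exact_mod_cast hn
    rw [hp.gen_eq n _ (by norm_num) (by norm_num), Function.comp_apply, ← mul_assoc,
      ← Real.rpow_add hn', show -(β / γ - 1) + β / γ = 1 by ring, Real.rpow_one]
  have hpos : 0 < 1 / (β - γ) := by
    have : γ < β := by rwa [one_lt_div h.γ_pos] at hσ1
    exact one_div_pos.2 (sub_pos.2 this)
  rw [Metric.tendsto_atTop]
  intro ε hε
  -- Eventually `n e₁` is below twice its limit, so this `N` makes `n e₁ / N < ε/2`.
  obtain ⟨N, hN⟩ := exists_nat_gt ((2 / (β - γ)) / (ε / 2))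
  have hN0 : (0 : ℝ) < N := lt_of_le_of_lt (div_nonneg (by
    rw [div_eq_mul_one_div]; positivity) (by positivity)) hN
  have e3 := (h1.eventually_lt_const (show 1 / (β - γ) < 2 / (β - γ) by
    rw [div_eq_mul_one_div 2]; linarith)).and
    (h2.eventually_lt_const (show 0 < ε / 2 / 2 ^ N by positivity))
  obtain ⟨n0, hn0⟩ := eventually_atTop.1 e3
  refine ⟨n0, fun n hn => ?_⟩
  obtain ⟨f1, f2⟩ := hn0 n hn
  rw [Real.dist_eq, sub_zero, abs_of_nonneg (mul_nonneg (Nat.cast_nonneg n)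
    (invMoment_nonneg (hp.nonneg n) 2))]
  have f3 := mul_le_mul_of_nonneg_left (invMoment_two_le_add (hp.nonneg n) (hp.total n).summable
    (N := N) (by exact_mod_cast hN0)) (Nat.cast_nonneg (α := ℝ) n)
  have f4 : (n : ℝ) * invMoment (p n) 1 / N < ε / 2 := by
    rw [div_lt_iff₀ (by positivity)] at hN
    rw [div_lt_iff₀ hN0]; linarith
  rw [lt_div_iff₀ (by positivity)] at f2
  have f5 : (n : ℝ) * (invMoment (p n) 1 / N + 2 ^ N * gen (p n) (1 / 2))
    = (n : ℝ) * invMoment (p n) 1 / N + (n : ℝ) * gen (p n) (1 / 2) * 2 ^ N := by ring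
  linarith

end Supercritical

/-! ### The first inverse moment for `σ = 1`. -/

section Boundary

lemma invMoment_one_sameOrder (h : Critical a b β γ ρ) (hp : IsLaw p a b) (hσ1 : β / γ = 1) :
    SameOrder (fun n => invMoment (p n) 1) (fun n : ℕ => Real.log n / n) := by
  obtain ⟨M, hM, hb⟩ := h.tailGen_bound hp
  obtain ⟨L, hL, hH⟩ := h.genZ_bounds
  have ha := h.a_pos
  rw [hσ1] at hb hH
  simp only [Real.rpow_neg_one] at hb hH
  set D := γ / (1 - a 0) with hD
  have hD0 : 0 < D := div_pos h.γ_pos (by linarith [h.a_lt])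
  set c := a 0 / 2 with hc
  have hc0 : 0 < c := by positivity
  have hcle : c ≤ 1 := by rw [hc]; linarith [h.a_lt]
  refine ⟨L⁻¹ / (2 * D), 2 * M / c, by positivity, by positivity, ?_⟩
  have hlog : Tendsto (fun n : ℕ => L⁻¹ / (2 * D) * Real.log n) atTop atTop :=
    (Real.tendsto_log_atTop.comp tendsto_natCast_atTop_atTop).const_mul_atTop (by positivity)
  -- The lower bound is about `L⁻¹(log D + log n)/(Dn)` minus the mass at `0`, which is `O(1/n)`.
  -- For these `n`, half of the `log n` term absorbs all the constants.
  filter_upwards [eventually_ge_atTop 2,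
    hlog.eventually_ge_atTop (L / a 0 - L⁻¹ / D * Real.log D)] with n hn hlogn
  have hn2 : (2 : ℝ) ≤ n := by exact_mod_cast hn
  have hn' : (0 : ℝ) < n := by linarith
  have hi := intervalIntegrable_tailGen (hp.nonneg n) (hp.total n).summable
  rw [← integral_tailGen (hp.nonneg n) (hp.total n).summable]
  constructor
  · have hDn : 0 < D * n := by positivity
    have h1 : ∫ s in (0 : ℝ)..1, (L⁻¹ * (1 + D * n * (1 - s))⁻¹ - p n 0)
        ≤ ∫ s in (0 : ℝ)..1, tailGen (p n) s := by
      refine intervalIntegral.integral_mono_on_of_le_Ioo zero_le_one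
        (((intervalIntegrable_one_add_inv hDn).const_mul _).sub intervalIntegrable_const) hi
        fun s hs => ?_
      have e1 := (hH s hs.1.le hs.2 n).2
      rw [← hp.gen_eq n s hs.1.le hs.2.le, gen_eq_add_tailGen (hp.nonneg n) (hp.total n).summable
        hs.1.le hs.2.le] at e1
      have e2 := mul_le_of_le_one_left (tailGen_nonneg (hp.nonneg n) hs.1.le) hs.2.le
      linarith
    rw [intervalIntegral.integral_sub ((intervalIntegrable_one_add_inv hDn).const_mul _)
      intervalIntegrable_const, intervalIntegral.integral_const_mul, integral_one_add_inv hDn,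
      intervalIntegral.integral_const, sub_zero, one_smul] at h1
    refine le_trans ?_ h1
    have e0 : p n 0 ≤ L / a 0 / n := by
      rw [law_zero hp]
      refine (hH 0 le_rfl zero_lt_one n).1.trans ?_
      rw [div_div, div_eq_mul_inv]
      have : (a 0 * n) ≤ 1 + a 0 * n * (1 - 0) := by linarith
      gcongr
    have e3 : Real.log D + Real.log n ≤ Real.log (1 + D * n) := by
      rw [← Real.log_mul hD0.ne' hn'.ne']
      exact Real.log_le_log hDn (by linarith)
    have e4 : L⁻¹ * ((Real.log D + Real.log n) / (D * n)) ≤ L⁻¹ * (Real.log (1 + D * n) / (D * n)) := by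
      gcongr
    have e5 : L⁻¹ / (2 * D) * (Real.log n / n)
        ≤ L⁻¹ * ((Real.log D + Real.log n) / (D * n)) - L / a 0 / n := by
      have : L⁻¹ * ((Real.log D + Real.log n) / (D * n)) - L / a 0 / n
          - L⁻¹ / (2 * D) * (Real.log n / n)
          = (L⁻¹ / (2 * D) * Real.log n - (L / a 0 - L⁻¹ / D * Real.log D)) / n := by
        field_simp; ring
      have h0 := div_nonneg (sub_nonneg.2 hlogn) hn'.le
      linarith
    linarith
  · have hcn : 0 < c * n := by positivity
    have h1 : ∫ s in (0 : ℝ)..1, tailGen (p n) s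
        ≤ ∫ s in (0 : ℝ)..1, M * (1 + c * n * (1 - s))⁻¹ :=
      intervalIntegral.integral_mono_on_of_le_Ioo zero_le_one hi
        ((intervalIntegrable_one_add_inv hcn).const_mul _) fun s hs => hb s hs.1.le hs.2 n
    rw [intervalIntegral.integral_const_mul, integral_one_add_inv hcn] at h1
    refine h1.trans ?_
    -- Because `c ≤ 1` and `n ≥ 2` give `1 + cn ≤ n²`.
    have e1 : Real.log (1 + c * n) ≤ 2 * Real.log n := by
      have : 2 * Real.log n = Real.log ((n : ℝ) ^ 2) := by rw [Real.log_pow]; norm_num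
      rw [this]
      refine Real.log_le_log (by positivity) ?_
      nlinarith
    calc M * (Real.log (1 + c * n) / (c * n)) ≤ M * (2 * Real.log n / (c * n)) := by gcongr
      _ = _ := by field_simp

end Boundary

end Critical

/-! ### Left limits of derivatives at 1 as factorial moments. -/

section Derivatives

lemma hasDerivAt_gen {w : ℕ → ℝ} (hw : ∀ k, 0 ≤ w k) (hs : Summable w)
    (h1 : Summable fun j : ℕ => w (j + 1) * ((j : ℝ) + 1)) {x : ℝ} (hx : x ∈ Set.Ioo (0 : ℝ) 1) :
    HasDerivAt (gen w) (gen (fun j : ℕ => w (j + 1) * ((j : ℝ) + 1)) x) x := by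
  have hu : Summable fun j : ℕ => w j * (j : ℝ) := by
    rw [← summable_nat_add_iff 1]; exact h1.congr fun j => by push_cast; rfl
  have hd := hasDerivAt_tsum_of_isPreconnected (g := fun (j : ℕ) (y : ℝ) => w j * y ^ j)
    (g' := fun (j : ℕ) (y : ℝ) => w j * (j * y ^ (j - 1))) hu isOpen_Ioo isPreconnected_Ioo
    (fun j y _ => (hasDerivAt_pow j y).const_mul (w j)) (fun j y hy => ?_) hx
    (summable_mul_pow hw hs hx.1.le hx.2.le) hx
  · refine hd.congr_deriv ?_
    have hsum : Summable fun j : ℕ => w j * (j * x ^ (j - 1)) := by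
      refine Summable.of_nonneg_of_le (fun j => mul_nonneg (hw j)
        (mul_nonneg (Nat.cast_nonneg j) (pow_nonneg hx.1.le _))) (fun j => ?_) hu
      exact mul_le_mul_of_nonneg_left (mul_le_of_le_one_right (Nat.cast_nonneg j)
        (pow_le_one₀ hx.1.le hx.2.le)) (hw j)
    rw [hsum.tsum_eq_zero_add, gen]
    simp [mul_assoc]
  · rw [Real.norm_of_nonneg (mul_nonneg (hw j)
        (mul_nonneg (Nat.cast_nonneg j) (pow_nonneg hy.1.le _)))]
    exact mul_le_mul_of_nonneg_left (mul_le_of_le_one_right (Nat.cast_nonneg j)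
        (pow_le_one₀ hy.1.le hy.2.le)) (hw j)

lemma tendsto_gen_one {w : ℕ → ℝ} (hw : ∀ k, 0 ≤ w k) (hs : Summable w) :
    Tendsto (gen w) (𝓝[<] 1) (𝓝 (∑' j, w j)) := by
  refine tendsto_tsum_of_dominated_convergence hs (fun j => ?_) ?_
  · have : Tendsto (fun x : ℝ => w j * x ^ j) (𝓝 1) (𝓝 (w j * 1 ^ j)) :=
      Continuous.tendsto (by fun_prop) 1
    rw [one_pow, mul_one] at this
    exact this.mono_left nhdsWithin_le_nhds
  · filter_upwards [Ioo_mem_nhdsLT (zero_lt_one (α := ℝ))] with x hx j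
    rw [Real.norm_of_nonneg (mul_nonneg (hw _) (pow_nonneg hx.1.le _))]
    exact mul_le_of_le_one_right (hw j) (pow_le_one₀ hx.1.le hx.2.le)

lemma tendsto_deriv_gen {w : ℕ → ℝ} (hw : ∀ k, 0 ≤ w k) (hs : Summable w)
    (h1 : Summable fun j : ℕ => w (j + 1) * ((j : ℝ) + 1)) :
    Tendsto (deriv (gen w)) (𝓝[<] 1) (𝓝 (∑' j : ℕ, w (j + 1) * ((j : ℝ) + 1))) := by
  refine (tendsto_gen_one (fun j => mul_nonneg (hw _) (by positivity)) h1).congr' ?_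
  filter_upwards [Ioo_mem_nhdsLT (zero_lt_one (α := ℝ))] with x hx
  exact (hasDerivAt_gen hw hs h1 hx).deriv.symm

lemma tendsto_deriv_deriv_gen {w : ℕ → ℝ} (hw : ∀ k, 0 ≤ w k) (hs : Summable w)
    (h1 : Summable fun j : ℕ => w (j + 1) * ((j : ℝ) + 1))
    (h2 : Summable fun j : ℕ => w (j + 1 + 1) * (((j + 1 : ℕ) : ℝ) + 1) * ((j : ℝ) + 1)) :
    Tendsto (deriv (deriv (gen w))) (𝓝[<] 1)
      (𝓝 (∑' j : ℕ, w (j + 1 + 1) * (((j + 1 : ℕ) : ℝ) + 1) * ((j : ℝ) + 1))) := by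
  refine (tendsto_deriv_gen (w := fun j : ℕ => w (j + 1) * ((j : ℝ) + 1))
    (fun j => mul_nonneg (hw _) (by positivity)) h1 h2).congr' ?_
  filter_upwards [Ioo_mem_nhdsLT (zero_lt_one (α := ℝ))] with x hx
  refine (EventuallyEq.deriv_eq ?_).symm
  filter_upwards [isOpen_Ioo.mem_nhds hx] with y hy
  exact (hasDerivAt_gen hw hs h1 hy).deriv

end Derivatives

/-! ### Expectations of `ℕ`-valued variables as sums. -/

lemma pmf_nonneg {Ω : Type*} [MeasurableSpace Ω] {P : Measure Ω} {W : Ω → ℕ} (j : ℕ) :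
    0 ≤ pmf P W j := measureReal_nonneg

lemma pairwise_disjoint_fiber {Ω : Type*} {W : Ω → ℕ} :
    Pairwise (Function.onFun Disjoint fun j : ℕ => {ω | W ω = j}) := by
  intro i j hij
  refine Set.disjoint_left.2 fun ω (h1 : W ω = i) (h2 : W ω = j) => hij (h1.symm.trans h2)

lemma iUnion_fiber {Ω : Type*} {W : Ω → ℕ} : ⋃ j : ℕ, {ω | W ω = j} = Set.univ :=
  Set.eq_univ_of_forall fun ω => Set.mem_iUnion.2 ⟨W ω, rfl⟩

section Moments

variable {Ω : Type*} [MeasurableSpace Ω] {P : Measure Ω} {W : Ω → ℕ}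

lemma measurableSet_eq (hW : Measurable W) (j : ℕ) : MeasurableSet {ω | W ω = j} :=
  hW (measurableSet_singleton j)

lemma setIntegral_fiber (hW : Measurable W) (f : ℕ → ℝ) (j : ℕ) :
    ∫ ω in {ω | W ω = j}, f (W ω) ∂P = pmf P W j * f j := by
  rw [setIntegral_congr_fun (measurableSet_eq hW j) (g := fun _ => f j)
    (fun ω (hω : W ω = j) => by simp only [hω]), setIntegral_const, smul_eq_mul]
  rfl

lemma hasSum_pmf_mul (hW : Measurable W) {f : ℕ → ℝ} (hf : Integrable (fun ω => f (W ω)) P) :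
    HasSum (fun j => pmf P W j * f j) (∫ ω, f (W ω) ∂P) := by
  have := hasSum_integral_iUnion (f := fun ω => f (W ω)) (measurableSet_eq hW)
    pairwise_disjoint_fiber hf.integrableOn
  simp only [iUnion_fiber, setIntegral_univ] at this
  refine this.congr_fun fun j => (setIntegral_fiber hW f j).symm

variable [IsProbabilityMeasure P]

lemma integrableOn_fiber (hW : Measurable W) (f : ℕ → ℝ) (j : ℕ) :
    IntegrableOn (fun ω => f (W ω)) {ω | W ω = j} P :=
  (integrableOn_congr_fun (g := fun _ => f j) (fun ω (hω : W ω = j) => by simp only [hω])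
    (measurableSet_eq hW j)).2 integrableOn_const

lemma integrable_comp (hW : Measurable W) {f : ℕ → ℝ}
    (hs : Summable fun j => pmf P W j * |f j|) : Integrable (fun ω => f (W ω)) P := by
  rw [← integrableOn_univ, ← iUnion_fiber (W := W)]
  refine integrableOn_iUnion_of_summable_integral_norm (fun j => integrableOn_fiber hW f j) ?_
  refine hs.congr fun j => ?_
  exact (setIntegral_fiber hW (fun j => ‖f j‖) j).symm

lemma hasSum_pmf (hW : Measurable W) : HasSum (pmf P W) 1 := by
  have := hasSum_pmf_mul (P := P) hW (f := fun _ => 1) (integrable_const _)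
  simpa using this

lemma integrable_pow (hW : Measurable W) {x : ℝ} (hx : 0 ≤ x) (hx1 : x ≤ 1) :
    Integrable (fun ω => x ^ W ω) P := by
  refine integrable_comp hW (f := fun j => x ^ j) ?_
  refine Summable.of_nonneg_of_le (fun j => mul_nonneg (pmf_nonneg j) (abs_nonneg _)) (fun j => ?_)
    (hasSum_pmf (P := P) hW).summable
  rw [abs_of_nonneg (by positivity)]
  exact mul_le_of_le_one_right (pmf_nonneg j) (pow_le_one₀ hx hx1)

lemma gen_pmf_eq (hW : Measurable W) {x : ℝ} (hx : 0 ≤ x) (hx1 : x ≤ 1) :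
    gen (pmf P W) x = ∫ ω, x ^ W ω ∂P :=
  (hasSum_pmf_mul hW (f := fun j => x ^ j) (integrable_pow hW hx hx1)).tsum_eq

end Moments

/-! ### Moments extracted from the standing assumption. -/

section Hypothesis

variable {Ω : Type*} [MeasurableSpace Ω] {P : Measure Ω} [IsProbabilityMeasure P]
  {ξ η : Ω → ℕ} {β γ : ℝ}

/-- For `j ≥ 3` one has `log j ≥ 1`; for `j ≤ 2` the factor `j²` is at most `4`. -/
lemma summable_sq_of_summable_log {a : ℕ → ℝ} (ha : ∀ j, 0 ≤ a j) (hs : Summable a)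
    (hl : Summable fun j : ℕ => a j * (j : ℝ) ^ 2 * Real.log j) :
    Summable fun j : ℕ => a j * (j : ℝ) ^ 2 := by
  refine Summable.of_nonneg_of_le (fun j => mul_nonneg (ha j) (by positivity)) (fun j => ?_)
    ((hs.mul_left 4).add hl)
  have hlog : 0 ≤ Real.log j := Real.log_natCast_nonneg j
  have haj := ha j
  rcases le_or_gt j 2 with hj | hj
  · have : (j : ℝ) ≤ 2 := by exact_mod_cast hj
    have h2 : (j : ℝ) ^ 2 ≤ 4 := by nlinarith [Nat.cast_nonneg (α := ℝ) j]
    have : 0 ≤ a j * (j : ℝ) ^ 2 * Real.log j := by positivity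
    nlinarith
  · have h3 : (3 : ℝ) ≤ j := by exact_mod_cast hj
    have : 1 ≤ Real.log j := by
      rw [Real.le_log_iff_exp_le (by linarith)]
      linarith [Real.exp_one_lt_d9]
    have : a j * (j : ℝ) ^ 2 ≤ a j * (j : ℝ) ^ 2 * Real.log j :=
      le_mul_of_one_le_right (by positivity) this
    linarith

lemma cast_le_sq (j : ℕ) : (j : ℝ) ≤ (j : ℝ) ^ 2 := by
  exact_mod_cast Nat.le_self_pow two_ne_zero j

lemma summable_mul_cast {w : ℕ → ℝ} (hw : ∀ j, 0 ≤ w j)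
    (h2 : Summable fun j : ℕ => w j * (j : ℝ) ^ 2) : Summable fun j : ℕ => w j * (j : ℝ) :=
  Summable.of_nonneg_of_le (fun j => mul_nonneg (hw j) (Nat.cast_nonneg j))
    (fun j => mul_le_mul_of_nonneg_left (cast_le_sq j) (hw j)) h2

lemma summable_mul_quadCoeff_one {w : ℕ → ℝ} (hw : ∀ j, 0 ≤ w j)
    (h2 : Summable fun j : ℕ => w j * (j : ℝ) ^ 2) : Summable fun j : ℕ => w j * quadCoeff j 1 := by
  refine Summable.of_nonneg_of_le (fun j => mul_nonneg (hw j) (quadCoeff_nonneg j zero_le_one))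
    (fun j => mul_le_mul_of_nonneg_left ?_ (hw j)) h2
  rw [quadCoeff_one]
  nlinarith [Nat.cast_nonneg (α := ℝ) j]

lemma HypH.summable_sq (hξ : Measurable ξ) (hH : HypH P ξ η β γ) :
    Summable fun j : ℕ => pmf P ξ j * (j : ℝ) ^ 2 :=
  summable_sq_of_summable_log pmf_nonneg (hasSum_pmf hξ).summable hH.summable_a

lemma HypH.memLp_offspring (hξ : Measurable ξ) (hH : HypH P ξ η β γ) :
    MemLp (fun ω => (ξ ω : ℝ)) 2 P := by
  refine (memLp_two_iff_integrable_sq (measurable_from_nat.comp hξ).aestronglyMeasurable).2 ?_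
  refine integrable_comp hξ (f := fun j => (j : ℝ) ^ 2) ((hH.summable_sq hξ).congr fun j => ?_)
  rw [abs_of_nonneg (by positivity)]

lemma HypH.memLp_immigration (hη : Measurable η) (hH : HypH P ξ η β γ) :
    MemLp (fun ω => (η ω : ℝ)) 2 P := by
  refine (memLp_two_iff_integrable_sq (measurable_from_nat.comp hη).aestronglyMeasurable).2 ?_
  refine integrable_comp hη (f := fun j => (j : ℝ) ^ 2) (hH.summable_b.congr fun j => ?_)
  rw [abs_of_nonneg (by positivity)]

lemma HypH.mean_immigration (hη : Measurable η) (hH : HypH P ξ η β γ) :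
    ∫ ω, (η ω : ℝ) ∂P = β := by
  have hs := summable_mul_cast (w := pmf P η) pmf_nonneg hH.summable_b
  have h0 := hasSum_pmf_mul hη (f := fun j => (j : ℝ))
    ((hH.memLp_immigration hη).integrable one_le_two)
  have hs1 : Summable fun j : ℕ => pmf P η (j + 1) * ((j : ℝ) + 1) :=
    ((summable_nat_add_iff 1).2 hs).congr fun j => by push_cast; rfl
  have h1 := tendsto_deriv_gen (w := pmf P η) pmf_nonneg (hasSum_pmf hη).summable hs1
  have h2 := tendsto_nhds_unique h1 hH.tendsto_β
  rw [← h2, ← h0.tsum_eq, hs.tsum_eq_zero_add]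
  simp

lemma HypH.hasSum_half (hξ : Measurable ξ) (hH : HypH P ξ η β γ) :
    HasSum (fun j : ℕ => pmf P ξ j * quadCoeff j 1) γ := by
  have hsq := hH.summable_sq hξ
  have hs := summable_mul_cast (w := pmf P ξ) pmf_nonneg hsq
  have hq := summable_mul_quadCoeff_one (w := pmf P ξ) pmf_nonneg hsq
  have hs1 : Summable fun j : ℕ => pmf P ξ (j + 1) * ((j : ℝ) + 1) :=
    ((summable_nat_add_iff 1).2 hs).congr fun j => by push_cast; rfl
  have e : ∀ j : ℕ, pmf P ξ (j + 1 + 1) * (((j + 1 : ℕ) : ℝ) + 1) * ((j : ℝ) + 1)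
      = 2 * (pmf P ξ (j + 2) * quadCoeff (j + 2) 1) := by
    intro j; rw [quadCoeff_one]; push_cast; ring
  have hs2 : Summable fun j : ℕ =>
      pmf P ξ (j + 1 + 1) * (((j + 1 : ℕ) : ℝ) + 1) * ((j : ℝ) + 1) := by
    simp only [e]
    exact ((summable_nat_add_iff 2).2 hq).mul_left 2
  have h1 := tendsto_deriv_deriv_gen (w := pmf P ξ) pmf_nonneg (hasSum_pmf hξ).summable hs1 hs2
  have h2 := tendsto_nhds_unique h1 hH.tendsto_γ
  simp only [e] at h2
  rw [tsum_mul_left] at h2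
  have h3 := hq.sum_add_tsum_nat_add 2
  have h4 : ∑ i ∈ Finset.range 2, pmf P ξ i * quadCoeff i 1 = 0 := by
    simp [Finset.sum_range_succ, quadCoeff_one]
  rw [h4, zero_add] at h3
  rw [hq.hasSum_iff, ← h3]
  linarith

lemma HypH.variance_offspring (hξ : Measurable ξ) (hH : HypH P ξ η β γ) :
    Var[fun ω => (ξ ω : ℝ); P] = 2 * γ := by
  have hm := hH.memLp_offspring hξ
  rw [variance_eq_sub hm, hH.critical]
  have h1 := hasSum_pmf_mul hξ (f := fun j => (j : ℝ)) (hm.integrable one_le_two)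
  have h2 := hasSum_pmf_mul hξ (f := fun j => (j : ℝ) ^ 2) hm.integrable_sq
  rw [hH.critical] at h1
  have h3 := ((hH.hasSum_half hξ).mul_left 2).add h1
  have : ∫ ω, (ξ ω : ℝ) ^ 2 ∂P = 2 * γ + 1 := by
    refine h2.unique (h3.congr_fun fun j => ?_)
    rw [quadCoeff_one]; ring
  have e : ∫ ω, ((fun ω => (ξ ω : ℝ)) ^ 2) ω ∂P = ∫ ω, (ξ ω : ℝ) ^ 2 ∂P := rfl
  rw [e, this]; ring

lemma HypH.critical_data (hξ : Measurable ξ) (hη : Measurable η) (hH : HypH P ξ η β γ) :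
    Critical (pmf P ξ) (pmf P η) β γ (∑' j, pmf P η j * quadCoeff j 1) where
  offspring :=
    { nonneg := pmf_nonneg
      total := hasSum_pmf hξ
      mean := by
        have := hasSum_pmf_mul hξ (f := fun j => (j : ℝ))
          ((hH.memLp_offspring hξ).integrable one_le_two)
        rwa [hH.critical] at this
      half := hH.hasSum_half hξ }
  immigration :=
    { nonneg := pmf_nonneg
      total := hasSum_pmf hη
      mean := by
        have := hasSum_pmf_mul hη (f := fun j => (j : ℝ))
          ((hH.memLp_immigration hη).integrable one_le_two)
        rwa [hH.mean_immigration hη] at this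
      half := (summable_mul_quadCoeff_one pmf_nonneg hH.summable_b).hasSum }
  summable_sq := hH.summable_sq hξ
  summable_log := hH.summable_a
  a_pos := hH.a_zero.1
  a_lt := hH.a_zero.2
  b_pos := hH.b_zero.1
  β_pos := hH.β_pos
  γ_pos := hH.γ_pos

end Hypothesis

/-! ### Independence and the law of one generation given the previous one. -/

/-- The size of generation `n + 1` when generation `n` has `k` individuals. -/
def nextGen {Ω : Type*} (X : ℕ → ℕ → Ω → ℕ) (Y : ℕ → Ω → ℕ) (n k : ℕ) (ω : Ω) : ℕ :=
  (∑ i ∈ Finset.range k, X n i ω) + Y n ω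

lemma Z_succ {Ω : Type*} (X : ℕ → ℕ → Ω → ℕ) (Y : ℕ → Ω → ℕ) (n : ℕ) (ω : Ω) :
    Z X Y (n + 1) ω = nextGen X Y n (Z X Y n ω) ω := rfl

lemma measurable_nextGen {Ω : Type*} {m : MeasurableSpace Ω} {X : ℕ → ℕ → Ω → ℕ}
    {Y : ℕ → Ω → ℕ} {n k : ℕ} (hX : ∀ i < k, Measurable[m] (X n i)) (hY : Measurable[m] (Y n)) :
    Measurable[m] (nextGen X Y n k) :=
  (Finset.measurable_fun_sum _ fun i hi => hX i (Finset.mem_range.1 hi)).add hY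

/-- Stated for an arbitrary `σ`-algebra so that it also applies to the one generated by the
variables of earlier generations. The random number of summands is harmless because the index is
countable. -/
lemma measurable_Z {Ω : Type*} {m : MeasurableSpace Ω} {X : ℕ → ℕ → Ω → ℕ} {Y : ℕ → Ω → ℕ}
    {n : ℕ} (hX : ∀ j < n, ∀ i, Measurable[m] (X j i)) (hY : ∀ j < n, Measurable[m] (Y j)) :
    Measurable[m] (Z X Y n) := by
  induction n with
  | zero => exact measurable_const
  | succ n ih =>
    have h1 := ih (fun j hj => hX j (by omega)) (fun j hj => hY j (by omega))
    have h2 : Measurable fun q : ℕ × Ω => nextGen X Y n q.1 q.2 :=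
      measurable_from_prod_countable_right fun k =>
        measurable_nextGen (fun i _ => hX n (by omega) i) (hY n (by omega))
    exact h2.comp (h1.prodMk measurable_id)

lemma nextGen_succ {Ω : Type*} {X : ℕ → ℕ → Ω → ℕ} {Y : ℕ → Ω → ℕ} (n k : ℕ) (ω : Ω) :
    nextGen X Y n (k + 1) ω = nextGen X Y n k ω + X n k ω := by
  simp only [nextGen, Finset.sum_range_succ]; ring

/-- The `σ`-algebra generated by a subfamily of the offspring and immigration variables. -/
abbrev subAlgebra {Ω : Type*} (X : ℕ → ℕ → Ω → ℕ) (Y : ℕ → Ω → ℕ) (S : Set ((ℕ × ℕ) ⊕ ℕ)) :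
    MeasurableSpace Ω :=
  ⨆ s ∈ S, MeasurableSpace.comap (Sum.elim (fun p : ℕ × ℕ => X p.1 p.2) Y s) inferInstance

lemma measurable_subAlgebra {Ω : Type*} {X : ℕ → ℕ → Ω → ℕ} {Y : ℕ → Ω → ℕ}
    {S : Set ((ℕ × ℕ) ⊕ ℕ)} {s : (ℕ × ℕ) ⊕ ℕ} (hs : s ∈ S) :
    Measurable[subAlgebra X Y S] (Sum.elim (fun p : ℕ × ℕ => X p.1 p.2) Y s) :=
  Measurable.of_comap_le (le_iSup₂ (f := fun s _ =>
    MeasurableSpace.comap (Sum.elim (fun p : ℕ × ℕ => X p.1 p.2) Y s) inferInstance) s hs)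

lemma ratio_eq {Ω : Type*} {X : ℕ → ℕ → Ω → ℕ} {Y : ℕ → Ω → ℕ}
    {n k : ℕ} {ω : Ω} (hω : Z X Y n ω = k + 1) :
    ratio X Y n ω = (nextGen X Y n (k + 1) ω : ℝ) / ((k : ℝ) + 1) := by
  rw [ratio, Z_succ, hω]; push_cast; rfl

lemma iUnion_pos {Ω : Type*} {X : ℕ → ℕ → Ω → ℕ} {Y : ℕ → Ω → ℕ} (n : ℕ) :
    ⋃ k : ℕ, {ω | Z X Y n ω = k + 1} = {ω | 0 < Z X Y n ω} := by
  ext ω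
  simp only [Set.mem_iUnion, Set.mem_ofPred_eq]
  exact ⟨fun ⟨k, hk⟩ => by omega, fun h => ⟨Z X Y n ω - 1, by omega⟩⟩

namespace IsGWI

variable {Ω : Type*} [MeasurableSpace Ω] {P : Measure Ω}
  {X : ℕ → ℕ → Ω → ℕ} {Y : ℕ → Ω → ℕ}

lemma measurable_gen (h : IsGWI P X Y) (n : ℕ) : Measurable (Z X Y n) :=
  measurable_Z (fun j _ i => h.measurable_X j i) fun j _ => h.measurable_Y j

lemma measurable_next (h : IsGWI P X Y) (n k : ℕ) : Measurable (nextGen X Y n k) :=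
  measurable_nextGen (fun i _ => h.measurable_X n i) (h.measurable_Y n)

lemma indepFun_of_disjoint (h : IsGWI P X Y) {S T : Set ((ℕ × ℕ) ⊕ ℕ)} (hST : Disjoint S T)
    {f g : Ω → ℕ} (hf : Measurable[subAlgebra X Y S] f) (hg : Measurable[subAlgebra X Y T] g) :
    IndepFun f g P := by
  rw [IndepFun_iff_Indep]
  have hm : ∀ s, Measurable (Sum.elim (fun p : ℕ × ℕ => X p.1 p.2) Y s) := by
    rintro (p | j)
    · exact h.measurable_X p.1 p.2
    · exact h.measurable_Y j
  have := indep_iSup_of_disjoint (fun s => (hm s).comap_le) h.indep hST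
  exact indep_of_indep_of_le_left (indep_of_indep_of_le_right this hg.comap_le) hf.comap_le

lemma measurableSet_pos (h : IsGWI P X Y) (n : ℕ) : MeasurableSet {ω | 0 < Z X Y n ω} :=
  h.measurable_gen n measurableSet_Ioi

lemma measurable_ratio (h : IsGWI P X Y) (n : ℕ) : Measurable (ratio X Y n) :=
  (measurable_from_nat.comp (h.measurable_gen (n + 1))).div
    (measurable_from_nat.comp (h.measurable_gen n))

/-- `Z_n` uses only variables with time index below `n`, the other function only those with index
`n`. -/
lemma indepFun_gen_next (h : IsGWI P X Y) (n k : ℕ) :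
    IndepFun (Z X Y n) (nextGen X Y n k) P := by
  refine h.indepFun_of_disjoint
    (S := {s | Sum.elim (fun p : ℕ × ℕ => p.1 < n) (fun j => j < n) s})
    (T := {s | Sum.elim (fun p : ℕ × ℕ => p.1 = n) (fun j => j = n) s}) ?_ ?_ ?_
  · refine Set.disjoint_left.2 ?_
    rintro (p | j) h1 h2
    · exact absurd (show p.1 = n from h2) (ne_of_lt (show p.1 < n from h1))
    · exact absurd (show j = n from h2) (ne_of_lt (show j < n from h1))
  · exact measurable_Z
      (fun j hj i => measurable_subAlgebra (X := X) (Y := Y) (s := Sum.inl (j, i)) hj)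
      (fun j hj => measurable_subAlgebra (X := X) (Y := Y) (s := Sum.inr j) hj)
  · exact measurable_nextGen
      (fun i _ => measurable_subAlgebra (X := X) (Y := Y) (s := Sum.inl (n, i)) rfl)
      (measurable_subAlgebra (X := X) (Y := Y) (s := Sum.inr n) rfl)

lemma indepFun_next_offspring (h : IsGWI P X Y) (n k : ℕ) :
    IndepFun (nextGen X Y n k) (X n k) P := by
  refine h.indepFun_of_disjoint
    (S := {s | Sum.elim (fun p : ℕ × ℕ => p.2 < k) (fun _ => True) s})
    (T := {s | Sum.elim (fun p : ℕ × ℕ => p = (n, k)) (fun _ => False) s}) ?_ ?_ ?_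
  · refine Set.disjoint_left.2 ?_
    rintro (p | j) h1 h2
    · have h3 : p = (n, k) := h2
      have h4 : p.2 < k := h1
      simp [h3] at h4
    · exact h2
  · exact measurable_nextGen
      (fun i hi => measurable_subAlgebra (X := X) (Y := Y) (s := Sum.inl (n, i)) hi)
      (measurable_subAlgebra (X := X) (Y := Y) (s := Sum.inr n) trivial)
  · exact measurable_subAlgebra (X := X) (Y := Y) (s := Sum.inl (n, k)) rfl

/-- By independence, conditioning on `Z_n = k` does not change the law of `nextGen X Y n k`. Written
without normalisation, it needs no positivity of the event. -/
lemma map_restrict_next (h : IsGWI P X Y) (n k : ℕ) :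
    (P.restrict {ω | Z X Y n ω = k}).map (nextGen X Y n k)
      = P {ω | Z X Y n ω = k} • P.map (nextGen X Y n k) := by
  ext s hs
  have hm := h.measurable_next n k
  rw [Measure.map_apply hm hs, Measure.restrict_apply (hm hs), Measure.smul_apply,
    Measure.map_apply hm hs, Set.inter_comm, smul_eq_mul]
  exact (h.indepFun_gen_next n k).measure_inter_preimage_eq_mul {k} s (measurableSet_singleton k) hs

lemma setIntegral_next (h : IsGWI P X Y) (n k : ℕ) (f : ℕ → ℝ) :
    ∫ ω in {ω | Z X Y n ω = k}, f (nextGen X Y n k ω) ∂P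
      = pmf P (Z X Y n) k * ∫ ω, f (nextGen X Y n k ω) ∂P := by
  have hm := h.measurable_next n k
  have hf : Measurable f := measurable_from_nat
  rw [← integral_map (f := f) hm.aemeasurable hf.aestronglyMeasurable, h.map_restrict_next,
    integral_smul_measure, integral_map hm.aemeasurable hf.aestronglyMeasurable]
  rfl

lemma setIntegral_ratio_pow (h : IsGWI P X Y) (n k r : ℕ) :
    ∫ ω in {ω | Z X Y n ω = k + 1}, ratio X Y n ω ^ r ∂P = pmf P (Z X Y n) (k + 1) *
      ((∫ ω, (nextGen X Y n (k + 1) ω : ℝ) ^ r ∂P) / ((k : ℝ) + 1) ^ r) := by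
  rw [setIntegral_congr_fun (measurableSet_eq (h.measurable_gen n) (k + 1))
    (g := fun ω => ((nextGen X Y n (k + 1) ω : ℝ) / ((k : ℝ) + 1)) ^ r)
    (fun ω (hω : Z X Y n ω = k + 1) => by simp only [ratio_eq hω]),
    h.setIntegral_next n (k + 1) (fun j => ((j : ℝ) / ((k : ℝ) + 1)) ^ r)]
  simp only [div_pow, integral_div]

variable [IsProbabilityMeasure P]

lemma integral_pow_next (h : IsGWI P X Y) {x : ℝ} (hx : 0 ≤ x) (hx1 : x ≤ 1) (n k : ℕ) :
    ∫ ω, x ^ nextGen X Y n k ω ∂P = gen (pmf P (X 0 0)) x ^ k * gen (pmf P (Y 0)) x := by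
  induction k with
  | zero =>
    rw [gen_pmf_eq (h.measurable_Y 0) hx hx1, pow_zero, one_mul]
    simp only [nextGen, Finset.range_zero, Finset.sum_empty, zero_add]
    exact ((h.identDistrib_Y n).comp (u := fun j : ℕ => x ^ j) measurable_from_nat).integral_eq
  | succ k ih =>
    have hi := (h.indepFun_next_offspring n k).comp (γ := ℝ) (γ' := ℝ)
      (_mγ := inferInstance) (_mγ' := inferInstance) (φ := fun j : ℕ => x ^ j)
      (ψ := fun j : ℕ => x ^ j) measurable_from_nat measurable_from_nat
    have := hi.integral_fun_mul_eq_mul_integral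
      (measurable_from_nat.comp (h.measurable_next n k)).aestronglyMeasurable
      (measurable_from_nat.comp (h.measurable_X n k)).aestronglyMeasurable
    simp only [nextGen_succ, pow_add]
    simp only [Function.comp_apply] at this
    have e : ∫ ω, x ^ X n k ω ∂P = gen (pmf P (X 0 0)) x := by
      rw [gen_pmf_eq (h.measurable_X 0 0) hx hx1]
      exact ((h.identDistrib_X n k).comp (u := fun j : ℕ => x ^ j) measurable_from_nat).integral_eq
    rw [this, ih, e]; ring

lemma integral_pow_succ (h : IsGWI P X Y) {x : ℝ} (hx : 0 ≤ x) (hx1 : x ≤ 1) (n : ℕ) :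
    gen (pmf P (Z X Y (n + 1))) x
      = gen (pmf P (Y 0)) x * gen (pmf P (Z X Y n)) (gen (pmf P (X 0 0)) x) := by
  rw [gen_pmf_eq (h.measurable_gen (n + 1)) hx hx1]
  have h1 := hasSum_integral_iUnion (f := fun ω => x ^ Z X Y (n + 1) ω)
    (measurableSet_eq (h.measurable_gen n)) pairwise_disjoint_fiber
    (integrable_pow (P := P) (h.measurable_gen (n + 1)) hx hx1).integrableOn
  simp only [iUnion_fiber, setIntegral_univ] at h1
  rw [← h1.tsum_eq, gen.eq_def (pmf P (Z X Y n)), ← tsum_mul_left]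
  refine tsum_congr fun k => ?_
  rw [setIntegral_congr_fun (measurableSet_eq (h.measurable_gen n) k)
    (g := fun ω => x ^ nextGen X Y n k ω)
    (fun ω (hω : Z X Y n ω = k) => by simp only [Z_succ, hω]),
    h.setIntegral_next n k (fun j => x ^ j), h.integral_pow_next hx hx1]
  ring

lemma isLaw (h : IsGWI P X Y) :
    IsLaw (fun n => pmf P (Z X Y n)) (pmf P (X 0 0)) (pmf P (Y 0)) where
  nonneg n k := pmf_nonneg k
  total n := hasSum_pmf (h.measurable_gen n)
  gen_eq n := by
    induction n with
    | zero =>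
      intro x hx hx1
      rw [gen_pmf_eq (h.measurable_gen 0) hx hx1]
      simp [Z, genZ]
    | succ n ih =>
      intro x hx hx1
      have h0 : 0 ≤ gen (pmf P (X 0 0)) x :=
        tsum_nonneg fun j => mul_nonneg (pmf_nonneg j) (pow_nonneg hx j)
      have h1 : gen (pmf P (X 0 0)) x ≤ 1 := by
        rw [gen_pmf_eq (h.measurable_X 0 0) hx hx1]
        calc _ ≤ ∫ _, (1 : ℝ) ∂P := integral_mono (integrable_pow (h.measurable_X 0 0) hx hx1)
              (integrable_const _) fun ω => pow_le_one₀ hx hx1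
          _ = 1 := by simp
      -- The recursion `H_{n+1}(x) = B(x) H_n(A(x))` acts on the inside, so the factor split off the
      -- product is the one with `m = 0`.
      rw [h.integral_pow_succ hx hx1, ih _ h0 h1, genZ, genZ, Finset.prod_range_succ', mul_comm]
      rfl

/-! ### Exact formulas for both variances through inverse moments. -/

variable {β γ : ℝ}

lemma memLp_next (h : IsGWI P X Y) (hH : HypH P (X 0 0) (Y 0) β γ) (n k : ℕ) :
    MemLp (fun ω => (nextGen X Y n k ω : ℝ)) 2 P := by
  have hX : ∀ i, MemLp (fun ω => (X n i ω : ℝ)) 2 P := fun i =>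
    ((h.identDistrib_X n i).comp (u := fun j : ℕ => (j : ℝ)) measurable_from_nat).memLp_iff.2
      (hH.memLp_offspring (h.measurable_X 0 0))
  have hY : MemLp (fun ω => (Y n ω : ℝ)) 2 P :=
    ((h.identDistrib_Y n).comp (u := fun j : ℕ => (j : ℝ)) measurable_from_nat).memLp_iff.2
      (hH.memLp_immigration (h.measurable_Y 0))
  simp only [nextGen, Nat.cast_add, Nat.cast_sum]
  exact (memLp_finsetSum _ fun i _ => hX i).add hY

lemma mean_next (h : IsGWI P X Y) (hH : HypH P (X 0 0) (Y 0) β γ) (n k : ℕ) :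
    ∫ ω, (nextGen X Y n k ω : ℝ) ∂P = k + β := by
  induction k with
  | zero =>
    rw [← hH.mean_immigration (h.measurable_Y 0)]
    simp only [nextGen, Finset.range_zero, Finset.sum_empty, zero_add, Nat.cast_zero]
    exact ((h.identDistrib_Y n).comp (u := fun j : ℕ => (j : ℝ)) measurable_from_nat).integral_eq
  | succ k ih =>
    have hid := (h.identDistrib_X n k).comp (u := fun j : ℕ => (j : ℝ)) measurable_from_nat
    have hX : MemLp (fun ω => (X n k ω : ℝ)) 2 P :=
      hid.memLp_iff.2 (hH.memLp_offspring (h.measurable_X 0 0))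
    simp only [nextGen_succ, Nat.cast_add]
    rw [integral_add ((h.memLp_next hH n k).integrable one_le_two) (hX.integrable one_le_two), ih]
    have e : ∫ ω, (X n k ω : ℝ) ∂P = 1 := hH.critical ▸ hid.integral_eq
    rw [e]; simp only [Nat.cast_one]; ring

lemma variance_next (h : IsGWI P X Y) (hH : HypH P (X 0 0) (Y 0) β γ) (n k : ℕ) :
    Var[fun ω => (nextGen X Y n k ω : ℝ); P] = 2 * γ * k + Var[fun ω => (Y 0 ω : ℝ); P] := by
  induction k with
  | zero =>
    simp only [nextGen, Finset.range_zero, Finset.sum_empty, zero_add, Nat.cast_zero, mul_zero]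
    exact ((h.identDistrib_Y n).comp (u := fun j : ℕ => (j : ℝ)) measurable_from_nat).variance_eq
  | succ k ih =>
    have hid := (h.identDistrib_X n k).comp (u := fun j : ℕ => (j : ℝ)) measurable_from_nat
    have hX : MemLp (fun ω => (X n k ω : ℝ)) 2 P :=
      hid.memLp_iff.2 (hH.memLp_offspring (h.measurable_X 0 0))
    have hi := (h.indepFun_next_offspring n k).comp (γ := ℝ) (γ' := ℝ)
      (_mγ := inferInstance) (_mγ' := inferInstance) (φ := fun j : ℕ => (j : ℝ))
      (ψ := fun j : ℕ => (j : ℝ)) measurable_from_nat measurable_from_nat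
    have hv := IndepFun.variance_add (h.memLp_next hH n k) hX hi
    have e : Var[fun ω => (X n k ω : ℝ); P] = 2 * γ :=
      hH.variance_offspring (h.measurable_X 0 0) ▸ hid.variance_eq
    rw [ih, e] at hv
    have e2 : (fun ω => (nextGen X Y n (k + 1) ω : ℝ))
        = (fun ω => (nextGen X Y n k ω : ℝ)) + fun ω => (X n k ω : ℝ) := by
      funext ω; simp [nextGen_succ]
    rw [e2, hv]; push_cast; ring

lemma integral_sq_next (h : IsGWI P X Y) (hH : HypH P (X 0 0) (Y 0) β γ) (n k : ℕ) :
    ∫ ω, (nextGen X Y n k ω : ℝ) ^ 2 ∂P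
      = 2 * γ * k + Var[fun ω => (Y 0 ω : ℝ); P] + (k + β) ^ 2 := by
  have h1 := variance_eq_sub (h.memLp_next hH n k)
  rw [h.variance_next hH, h.mean_next hH] at h1
  have : ∫ ω, ((fun ω => (nextGen X Y n k ω : ℝ)) ^ 2) ω ∂P
    = ∫ ω, (nextGen X Y n k ω : ℝ) ^ 2 ∂P := rfl
  linarith

lemma measureReal_pos (h : IsGWI P X Y) (n : ℕ) :
    P.real {ω | 0 < Z X Y n ω} = 1 - pmf P (Z X Y n) 0 := by
  have : {ω | 0 < Z X Y n ω} = {ω | Z X Y n ω = 0}ᶜ := by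
    ext ω; simp [Nat.pos_iff_ne_zero]
  rw [this, probReal_compl_eq_one_sub (measurableSet_eq (h.measurable_gen n) 0)]
  rfl

lemma hasSum_pmf_pos (h : IsGWI P X Y) (n : ℕ) :
    HasSum (fun k => pmf P (Z X Y n) (k + 1)) (1 - pmf P (Z X Y n) 0) := by
  have := (hasSum_nat_add_iff' 1).2 (hasSum_pmf (P := P) (h.measurable_gen n))
  simpa using this

lemma hasSum_invMoment (h : IsGWI P X Y) (n q : ℕ) :
    HasSum (fun k : ℕ => pmf P (Z X Y n) (k + 1) / ((k : ℝ) + 1) ^ q)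
      (invMoment (pmf P (Z X Y n)) q) :=
  (summable_div_pow pmf_nonneg (hasSum_pmf (h.measurable_gen n)).summable q).hasSum

/-- Divide `2γk + D + (k+β)²` by `k²` and sort by powers of `1/k`. -/
lemma hasSum_sq_ratio (h : IsGWI P X Y) (hH : HypH P (X 0 0) (Y 0) β γ) (n : ℕ) :
    HasSum (fun k : ℕ => ∫ ω in {ω | Z X Y n ω = k + 1}, ratio X Y n ω ^ 2 ∂P)
      ((1 - pmf P (Z X Y n) 0) + (2 * γ + 2 * β) * invMoment (pmf P (Z X Y n)) 1
        + (Var[fun ω => (Y 0 ω : ℝ); P] + β ^ 2) * invMoment (pmf P (Z X Y n)) 2) := by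
  refine (((h.hasSum_pmf_pos n).add ((h.hasSum_invMoment n 1).mul_left _)).add
    ((h.hasSum_invMoment n 2).mul_left _)).congr_fun fun k => ?_
  rw [h.setIntegral_ratio_pow, h.integral_sq_next hH]
  push_cast
  field_simp; ring

lemma integrableOn_sq_ratio (h : IsGWI P X Y) (hH : HypH P (X 0 0) (Y 0) β γ) (n : ℕ) :
    IntegrableOn (fun ω => ratio X Y n ω ^ 2) {ω | 0 < Z X Y n ω} P := by
  rw [← iUnion_pos]
  refine integrableOn_iUnion_of_summable_integral_norm (fun k => ?_) ?_
  · refine (integrableOn_congr_fun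
      (g := fun ω => (nextGen X Y n (k + 1) ω : ℝ) ^ 2 / ((k : ℝ) + 1) ^ 2)
      (fun ω (hω : Z X Y n ω = k + 1) => by simp only [ratio_eq hω, div_pow])
      (measurableSet_eq (h.measurable_gen n) (k + 1))).2 ?_
    exact ((h.memLp_next hH n (k + 1)).integrable_sq.div_const _).integrableOn
  · refine (h.hasSum_sq_ratio hH n).summable.congr fun k => ?_
    simp only [Real.norm_of_nonneg (sq_nonneg _)]

lemma setIntegral_sq_ratio (h : IsGWI P X Y) (hH : HypH P (X 0 0) (Y 0) β γ) (n : ℕ) :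
    ∫ ω in {ω | 0 < Z X Y n ω}, ratio X Y n ω ^ 2 ∂P
      = (1 - pmf P (Z X Y n) 0) + (2 * γ + 2 * β) * invMoment (pmf P (Z X Y n)) 1
        + (Var[fun ω => (Y 0 ω : ℝ); P] + β ^ 2) * invMoment (pmf P (Z X Y n)) 2 := by
  have h1 := h.integrableOn_sq_ratio hH n
  rw [← iUnion_pos] at h1 ⊢
  refine (hasSum_integral_iUnion (fun k => measurableSet_eq (h.measurable_gen n) (k + 1)) ?_
    h1).unique (h.hasSum_sq_ratio hH n)
  exact fun i j hij => pairwise_disjoint_fiber (by omega)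

lemma memLp_ratio (h : IsGWI P X Y) (hH : HypH P (X 0 0) (Y 0) β γ) (n : ℕ) :
    MemLp (ratio X Y n) 2 (P.restrict {ω | 0 < Z X Y n ω}) :=
  (memLp_two_iff_integrable_sq (h.measurable_ratio n).aestronglyMeasurable).2
    (h.integrableOn_sq_ratio hH n)

lemma setIntegral_ratio (h : IsGWI P X Y) (hH : HypH P (X 0 0) (Y 0) β γ) (n : ℕ) :
    ∫ ω in {ω | 0 < Z X Y n ω}, ratio X Y n ω ∂P
      = (1 - pmf P (Z X Y n) 0) + β * invMoment (pmf P (Z X Y n)) 1 := by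
  have h1 : IntegrableOn (ratio X Y n) {ω | 0 < Z X Y n ω} P :=
    (h.memLp_ratio hH n).integrable one_le_two
  rw [← iUnion_pos] at h1 ⊢
  refine (hasSum_integral_iUnion (fun k => measurableSet_eq (h.measurable_gen n) (k + 1)) ?_
    h1).unique (((h.hasSum_pmf_pos n).add ((h.hasSum_invMoment n 1).mul_left _)).congr_fun
    fun k => ?_)
  · exact fun i j hij => pairwise_disjoint_fiber (by omega)
  · have := h.setIntegral_ratio_pow n k 1
    simp only [pow_one] at this
    rw [this, h.mean_next hH]
    push_cast
    field_simp

/-- The conditional variance of the ratio in terms of the inverse moments of `Z_n`. -/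
lemma J_eq (h : IsGWI P X Y) (hH : HypH P (X 0 0) (Y 0) β γ) {n : ℕ}
    (hn : pmf P (Z X Y n) 0 < 1) :
    J P X Y n = (2 * γ * invMoment (pmf P (Z X Y n)) 1
      + (Var[fun ω => (Y 0 ω : ℝ); P] + β ^ 2) * invMoment (pmf P (Z X Y n)) 2)
        / (1 - pmf P (Z X Y n) 0)
      - (β * invMoment (pmf P (Z X Y n)) 1 / (1 - pmf P (Z X Y n) 0)) ^ 2 := by
  have hq : 0 < 1 - pmf P (Z X Y n) 0 := sub_pos.2 hn
  have hE : P {ω | 0 < Z X Y n ω} ≠ 0 := by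
    intro h0
    have := h.measureReal_pos n
    rw [measureReal_def, h0] at this
    simp at this; linarith
  have := cond_isProbabilityMeasure hE
  have hL : MemLp (ratio X Y n) 2 (P[|{ω | 0 < Z X Y n ω}]) :=
    (h.memLp_ratio hH n).smul_measure (ENNReal.inv_ne_top.2 hE)
  have hi : ∀ f : Ω → ℝ, ∫ ω, f ω ∂(P[|{ω | 0 < Z X Y n ω}])
      = (∫ ω in {ω | 0 < Z X Y n ω}, f ω ∂P) / (1 - pmf P (Z X Y n) 0) := by
    intro f
    rw [ProbabilityTheory.cond, integral_smul_measure, ENNReal.toReal_inv, ← measureReal_def,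
      h.measureReal_pos, smul_eq_mul, div_eq_inv_mul]
  rw [J, variance_eq_sub hL, hi, hi]
  have e : ∫ ω in {ω | 0 < Z X Y n ω}, (ratio X Y n ^ 2) ω ∂P
      = ∫ ω in {ω | 0 < Z X Y n ω}, ratio X Y n ω ^ 2 ∂P := rfl
  rw [e, h.setIntegral_sq_ratio hH, h.setIntegral_ratio hH]
  -- The mean is `1 + βe₁/q₀`; the cross term of its square cancels the `2βe₁/q₀` in the second
  -- moment.
  field_simp; ring

lemma variance_ratio_cond (h : IsGWI P X Y) (hH : HypH P (X 0 0) (Y 0) β γ) {n k : ℕ}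
    (hk : pmf P (Z X Y n) (k + 1) ≠ 0) :
    Var[ratio X Y n; P[|{ω | Z X Y n ω = k + 1}]]
      = (2 * γ * ((k : ℝ) + 1) + Var[fun ω => (Y 0 ω : ℝ); P]) / ((k : ℝ) + 1) ^ 2 := by
  have hE : P {ω | Z X Y n ω = k + 1} ≠ 0 := fun h0 => hk (by
    rw [pmf, measureReal_def, h0]; rfl)
  have hmap : (P[|{ω | Z X Y n ω = k + 1}]).map (nextGen X Y n (k + 1))
      = P.map (nextGen X Y n (k + 1)) := by
    rw [ProbabilityTheory.cond, Measure.map_smul, h.map_restrict_next, smul_smul,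
      ENNReal.inv_mul_cancel hE (measure_ne_top _ _), one_smul]
  have hm := h.measurable_next n (k + 1)
  have hid : IdentDistrib (nextGen X Y n (k + 1)) (nextGen X Y n (k + 1))
      (P[|{ω | Z X Y n ω = k + 1}]) P := ⟨hm.aemeasurable, hm.aemeasurable, hmap⟩
  have hv := (hid.comp (u := fun j : ℕ => ((k : ℝ) + 1)⁻¹ * (j : ℝ))
    measurable_from_nat).variance_eq
  have hae : ratio X Y n =ᵐ[P[|{ω | Z X Y n ω = k + 1}]]
      (fun j : ℕ => ((k : ℝ) + 1)⁻¹ * (j : ℝ)) ∘ nextGen X Y n (k + 1) := by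
    filter_upwards [ae_cond_mem (measurableSet_eq (h.measurable_gen n) (k + 1))] with ω hω
    rw [ratio_eq hω, Function.comp_apply, div_eq_inv_mul]
  rw [variance_congr hae, hv]
  have := variance_const_mul ((k : ℝ) + 1)⁻¹ (fun ω => (nextGen X Y n (k + 1) ω : ℝ)) P
  rw [h.variance_next hH] at this
  refine this.trans ?_
  push_cast
  field_simp

lemma meanCondVar_eq (h : IsGWI P X Y) (hH : HypH P (X 0 0) (Y 0) β γ) (n : ℕ) :
    meanCondVar P X Y n = (2 * γ * invMoment (pmf P (Z X Y n)) 1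
      + Var[fun ω => (Y 0 ω : ℝ); P] * invMoment (pmf P (Z X Y n)) 2)
        / (1 - pmf P (Z X Y n) 0) := by
  refine HasSum.tsum_eq (((((h.hasSum_invMoment n 1).mul_left (2 * γ)).add
    ((h.hasSum_invMoment n 2).mul_left Var[fun ω => (Y 0 ω : ℝ); P])).div_const _).congr_fun
    fun k => ?_)
  have e : pmf (P[|{ω | 0 < Z X Y n ω}]) (Z X Y n) (k + 1)
      = pmf P (Z X Y n) (k + 1) / (1 - pmf P (Z X Y n) 0) := by
    have hs : {ω | 0 < Z X Y n ω} ∩ {ω | Z X Y n ω = k + 1} = {ω | Z X Y n ω = k + 1} :=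
      Set.inter_eq_right.2 fun ω (hω : Z X Y n ω = k + 1) => by
        show 0 < Z X Y n ω
        omega
    rw [pmf, measureReal_def, cond_apply (h.measurableSet_pos n), hs, ENNReal.toReal_mul,
      ENNReal.toReal_inv, ← measureReal_def, h.measureReal_pos, div_eq_inv_mul]
    rfl
  rw [e]
  -- Values of mass zero contribute zero to both sums, so the conditional variance is needed only
  -- where the conditioning event has positive mass.
  by_cases hk : pmf P (Z X Y n) (k + 1) = 0
  · simp [hk]
  · rw [h.variance_ratio_cond hH hk]
    field_simp

end IsGWI

/-! ### From inverse moments to the two variances. -/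

lemma isEquivalent_mul_inv {u r : ℕ → ℝ} {κ : ℝ} (hκ : κ ≠ 0) (hr : Tendsto r atTop atTop)
    (h : Tendsto (fun n => r n * u n) atTop (𝓝 κ)) : u ~[atTop] fun n => κ * (r n)⁻¹ := by
  have hr0 := hr.eventually_gt_atTop 0
  refine (isEquivalent_iff_tendsto_one ?_).2 ?_
  · filter_upwards [hr0] with n hn
    exact mul_ne_zero hκ (inv_ne_zero hn.ne')
  · have := h.div_const κ
    rw [div_self hκ] at this
    refine this.congr' ?_
    filter_upwards [hr0] with n hn
    rw [Pi.div_apply]; field_simp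

namespace IsGWI

variable {Ω : Type*} [MeasurableSpace Ω] {P : Measure Ω} [IsProbabilityMeasure P]
  {X : ℕ → ℕ → Ω → ℕ} {Y : ℕ → Ω → ℕ} {β γ : ℝ}

lemma tendsto_pmf_zero (h : IsGWI P X Y) (hH : HypH P (X 0 0) (Y 0) β γ) :
    Tendsto (fun n => pmf P (Z X Y n) 0) atTop (𝓝 0) :=
  (hH.critical_data (h.measurable_X 0 0) (h.measurable_Y 0)).tendsto_law_zero h.isLaw

lemma tendsto_mul_meanCondVar (h : IsGWI P X Y) (hH : HypH P (X 0 0) (Y 0) β γ) {r : ℕ → ℝ}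
    {L₁ L₂ : ℝ} (h1 : Tendsto (fun n => r n * invMoment (pmf P (Z X Y n)) 1) atTop (𝓝 L₁))
    (h2 : Tendsto (fun n => r n * invMoment (pmf P (Z X Y n)) 2) atTop (𝓝 L₂)) :
    Tendsto (fun n => r n * meanCondVar P X Y n) atTop
      (𝓝 (2 * γ * L₁ + Var[fun ω => (Y 0 ω : ℝ); P] * L₂)) := by
  have hq := (tendsto_const_nhds (x := (1 : ℝ))).sub (h.tendsto_pmf_zero hH)
  have := ((h1.const_mul (2 * γ)).add (h2.const_mul Var[fun ω => (Y 0 ω : ℝ); P])).div hq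
    (by norm_num)
  rw [sub_zero, div_one] at this
  refine this.congr fun n => ?_
  rw [h.meanCondVar_eq hH, Pi.div_apply]; ring

/-- The squared-mean correction is `r e₁ · e₁` up to bounded factors, and `e₁ = (r e₁)/r → 0`, so it
drops out of the limit. -/
lemma tendsto_mul_J (h : IsGWI P X Y) (hH : HypH P (X 0 0) (Y 0) β γ) {r : ℕ → ℝ}
    {L₁ L₂ : ℝ} (hr : Tendsto r atTop atTop)
    (h1 : Tendsto (fun n => r n * invMoment (pmf P (Z X Y n)) 1) atTop (𝓝 L₁))
    (h2 : Tendsto (fun n => r n * invMoment (pmf P (Z X Y n)) 2) atTop (𝓝 L₂)) :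
    Tendsto (fun n => r n * J P X Y n) atTop
      (𝓝 (2 * γ * L₁ + (Var[fun ω => (Y 0 ω : ℝ); P] + β ^ 2) * L₂)) := by
  have h0 := h.tendsto_pmf_zero hH
  have hq := (tendsto_const_nhds (x := (1 : ℝ))).sub h0
  have he : Tendsto (fun n => invMoment (pmf P (Z X Y n)) 1) atTop (𝓝 0) := by
    have := (tendsto_inv_atTop_zero.comp hr).mul h1
    rw [zero_mul] at this
    refine this.congr' ?_
    filter_upwards [hr.eventually_gt_atTop 0] with n hn
    rw [Function.comp_apply]; field_simp
  have h3 := ((h1.const_mul (2 * γ)).add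
    (h2.const_mul (Var[fun ω => (Y 0 ω : ℝ); P] + β ^ 2))).div hq (by norm_num)
  have h4 := ((h1.mul he).const_mul (β ^ 2)).div (hq.pow 2) (by norm_num)
  have h5 := h3.sub h4
  rw [sub_zero, div_one, mul_zero, mul_zero, zero_div, sub_zero] at h5
  refine h5.congr' ?_
  filter_upwards [h0.eventually_lt_const zero_lt_one] with n hn
  rw [h.J_eq hH hn, Pi.div_apply, Pi.div_apply]
  generalize 1 - pmf P (Z X Y n) 0 = q
  ring

lemma sameOrder_boundary (h : IsGWI P X Y) (hH : HypH P (X 0 0) (Y 0) β γ) (hσ : β / γ = 1) :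
    SameOrder (J P X Y) (fun n : ℕ => Real.log n / n) ∧
      SameOrder (meanCondVar P X Y) (fun n : ℕ => Real.log n / n) := by
  obtain ⟨C₁, C₂, hC₁, hC₂, hC⟩ :=
    (hH.critical_data (h.measurable_X 0 0) (h.measurable_Y 0)).invMoment_one_sameOrder h.isLaw hσ
  have hγ := hH.γ_pos
  set D := Var[fun ω => (Y 0 ω : ℝ); P] with hD
  have hD0 : 0 ≤ D := variance_nonneg _ _
  have hlog : Tendsto (fun n : ℕ => C₂ * (Real.log n / n)) atTop (𝓝 0) := by
    have := (Real.isLittleO_log_id_atTop.tendsto_div_nhds_zero.comp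
      tendsto_natCast_atTop_atTop).const_mul C₂
    rw [mul_zero] at this
    exact this
  -- With `1/q < 2` this gives `(βe₁/q)² ≤ 4β²e₁² ≤ γe₁`, so the subtracted square uses up at most
  -- half of the main term `2γe₁`.
  have hsmall : ∀ᶠ n : ℕ in atTop, 4 * β ^ 2 * (C₂ * (Real.log n / n)) < γ := by
    have := hlog.const_mul (4 * β ^ 2)
    rw [mul_zero] at this
    exact this.eventually_lt_const hγ
  have h0 := (h.tendsto_pmf_zero hH).eventually_lt_const (show (0 : ℝ) < 1 / 2 by norm_num)
  have hfacts : ∀ n, 0 ≤ invMoment (pmf P (Z X Y n)) 1 ∧ 0 ≤ invMoment (pmf P (Z X Y n)) 2 ∧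
      invMoment (pmf P (Z X Y n)) 2 ≤ invMoment (pmf P (Z X Y n)) 1 := fun n =>
    ⟨invMoment_nonneg pmf_nonneg 1, invMoment_nonneg pmf_nonneg 2,
      invMoment_two_le pmf_nonneg (hasSum_pmf (h.measurable_gen n)).summable⟩
  have hquot : ∀ {u q : ℝ}, 0 ≤ u → 1 / 2 < q → q ≤ 1 → u ≤ u / q ∧ u / q ≤ 2 * u := by
    intro u q hu hq hq1
    have hq0 : 0 < q := by linarith
    rw [le_div_iff₀ hq0, div_le_iff₀ hq0]
    constructor <;> nlinarith
  constructor
  · refine ⟨γ * C₁, 2 * (2 * γ + D + β ^ 2) * C₂, by positivity, by positivity, ?_⟩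
    filter_upwards [hC, hsmall, h0] with n hn hs hn0
    obtain ⟨f1, f2, f3⟩ := hfacts n
    rw [h.J_eq hH (by linarith), ← hD]
    set e₁ := invMoment (pmf P (Z X Y n)) 1
    set e₂ := invMoment (pmf P (Z X Y n)) 2
    set q := 1 - pmf P (Z X Y n) 0
    have hq : 1 / 2 < q := by simp only [q]; linarith
    have hq1 : q ≤ 1 := by simp only [q]; linarith [pmf_nonneg (P := P) (W := Z X Y n) 0]
    have g1 : 0 ≤ 2 * γ * e₁ := by positivity
    have g2 : 0 ≤ (D + β ^ 2) * e₂ := by positivity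
    have g3 : (D + β ^ 2) * e₂ ≤ (D + β ^ 2) * e₁ := mul_le_mul_of_nonneg_left f3 (by positivity)
    have k1 := hquot (add_nonneg g1 g2) hq hq1
    have k2 := hquot f1 hq hq1
    have k3 : (β * e₁ / q) ^ 2 ≤ γ * e₁ := by
      rw [mul_div_assoc, mul_pow]
      have a1 : (e₁ / q) ^ 2 ≤ (2 * e₁) ^ 2 := pow_le_pow_left₀ (f1.trans k2.1) k2.2 2
      have a2 : β ^ 2 * (e₁ / q) ^ 2 ≤ β ^ 2 * (2 * e₁) ^ 2 :=
        mul_le_mul_of_nonneg_left a1 (sq_nonneg β)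
      have a3 : 4 * β ^ 2 * e₁ ≤ γ :=
        (mul_le_mul_of_nonneg_left hn.2 (by positivity)).trans hs.le
      have a4 := mul_le_mul_of_nonneg_right a3 f1
      linarith [show β ^ 2 * (2 * e₁) ^ 2 = 4 * β ^ 2 * e₁ * e₁ by ring]
    have k4 := mul_le_mul_of_nonneg_left hn.1 hγ.le
    have k5 := mul_le_mul_of_nonneg_left hn.2
      (by positivity : 0 ≤ 2 * (2 * γ + D + β ^ 2))
    constructor
    · linarith [k1.1]
    · linarith [k1.2, sq_nonneg (β * e₁ / q)]
  · refine ⟨2 * γ * C₁, 2 * (2 * γ + D) * C₂, by positivity, by positivity, ?_⟩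
    filter_upwards [hC, h0] with n hn hn0
    obtain ⟨f1, f2, f3⟩ := hfacts n
    rw [h.meanCondVar_eq hH, ← hD]
    set e₁ := invMoment (pmf P (Z X Y n)) 1
    set e₂ := invMoment (pmf P (Z X Y n)) 2
    set q := 1 - pmf P (Z X Y n) 0
    have hq : 1 / 2 < q := by simp only [q]; linarith
    have hq1 : q ≤ 1 := by simp only [q]; linarith [pmf_nonneg (P := P) (W := Z X Y n) 0]
    have g1 : 0 ≤ 2 * γ * e₁ := by positivity
    have g2 : 0 ≤ D * e₂ := by positivity
    have g3 : D * e₂ ≤ D * e₁ := mul_le_mul_of_nonneg_left f3 hD0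
    have k1 := hquot (add_nonneg g1 g2) hq hq1
    have k4 := mul_le_mul_of_nonneg_left hn.1 (by positivity : 0 ≤ 2 * γ)
    have k5 := mul_le_mul_of_nonneg_left hn.2 (by positivity : 0 ≤ 2 * (2 * γ + D))
    constructor
    · linarith [k1.1]
    · linarith [k1.2]

end IsGWI

end

end GWI

/-! ### The three regimes assembled. -/

theorem theorem3p3 {Ω : Type*} [MeasurableSpace Ω] (P : Measure Ω) [IsProbabilityMeasure P]
    (X : ℕ → ℕ → Ω → ℕ) (Y : ℕ → Ω → ℕ) (hGWI : GWI.IsGWI P X Y)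
    (β γ σ : ℝ) (hH : GWI.HypH P (X 0 0) (Y 0) β γ) (hσ : σ = β / γ)
    (hY_pos : 0 < evariance (fun ω => (Y 0 ω : ℝ)) P)
    (hY_fin : evariance (fun ω => (Y 0 ω : ℝ)) P < ⊤) :
    (σ < 1 → ∃ (U : ℝ → ℝ) (μ : ℕ → ℝ),
      (∀ x : ℝ, 0 ≤ x → x < 1 →
        Tendsto (fun n : ℕ => (n : ℝ) ^ σ * GWI.pgf P (GWI.Z X Y n) x) atTop (𝓝 (U x))) ∧
      (∀ j : ℕ,
        Tendsto (fun n : ℕ => (n : ℝ) ^ σ * GWI.pmf P (GWI.Z X Y n) j) atTop (𝓝 (μ j))) ∧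
      IntervalIntegrable (fun s => (U s - U 0) / s) volume 0 1 ∧
      Summable (fun k : ℕ => μ (k + 1) / ((k : ℝ) + 1) ^ 2) ∧
      (GWI.J P X Y ~[atTop] fun n : ℕ =>
        (2 * γ * (∫ s in (0 : ℝ)..1, (U s - U 0) / s) +
          (∫ ω, (Y 0 ω : ℝ) ^ 2 ∂P) * ∑' k : ℕ, μ (k + 1) / ((k : ℝ) + 1) ^ 2)
          * (n : ℝ) ^ (-σ)) ∧
      (GWI.meanCondVar P X Y ~[atTop] fun n : ℕ =>
        (2 * γ * (∫ s in (0 : ℝ)..1, (U s - U 0) / s) +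
          Var[fun ω => (Y 0 ω : ℝ); P] * ∑' k : ℕ, μ (k + 1) / ((k : ℝ) + 1) ^ 2)
          * (n : ℝ) ^ (-σ))) ∧
    (σ = 1 →
      GWI.SameOrder (GWI.J P X Y) (fun n : ℕ => Real.log n / n) ∧
      GWI.SameOrder (GWI.meanCondVar P X Y) (fun n : ℕ => Real.log n / n)) ∧
    (1 < σ → σ ≠ 2 →
      (GWI.J P X Y ~[atTop] fun n : ℕ => 2 * γ / ((n : ℝ) * (β - γ))) ∧
      (GWI.meanCondVar P X Y ~[atTop] fun n : ℕ => 2 * γ / ((n : ℝ) * (β - γ)))) := by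
  subst hσ
  have hc := hH.critical_data (hGWI.measurable_X 0 0) (hGWI.measurable_Y 0)
  have hp := hGWI.isLaw
  have hγ := hH.γ_pos
  have hY2 : ∫ ω, (Y 0 ω : ℝ) ^ 2 ∂P = Var[fun ω => (Y 0 ω : ℝ); P] + β ^ 2 := by
    have h1 := variance_eq_sub (hH.memLp_immigration (hGWI.measurable_Y 0))
    rw [hH.mean_immigration (hGWI.measurable_Y 0)] at h1
    have h2 : ∫ ω, ((fun ω => (Y 0 ω : ℝ)) ^ 2) ω ∂P = ∫ ω, (Y 0 ω : ℝ) ^ 2 ∂P := rfl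
    linarith
  refine ⟨fun hσ => ?_, hGWI.sameOrder_boundary hH, fun hσ _ => ?_⟩
  · choose μ hμ using hc.exists_tendsto_law hp
    obtain ⟨hUi, hU⟩ := hc.invMoment_one_asymp hp hσ
    obtain ⟨hμs, hμl⟩ := hc.invMoment_two_asymp hp hσ hμ
    -- Makes `κ` and `κ̄` nonzero, without which a limit of `n^σ J_n` would not yield an asymptotic
    -- equivalence.
    have hpos := hc.integral_limitGen_pos hp hσ
    have hμ0 : 0 ≤ ∑' k : ℕ, μ (k + 1) / ((k : ℝ) + 1) ^ 2 := by
      refine tsum_nonneg fun k => div_nonneg ?_ (by positivity)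
      exact ge_of_tendsto' (hμ (k + 1)) fun n => mul_nonneg (by positivity) (hp.nonneg n _)
    have hr : Tendsto (fun n : ℕ => (n : ℝ) ^ (β / γ)) atTop atTop :=
      (tendsto_rpow_atTop (div_pos hc.β_pos hγ)).comp tendsto_natCast_atTop_atTop
    have hinv : ∀ n : ℕ, (n : ℝ) ^ (-(β / γ)) = ((n : ℝ) ^ (β / γ))⁻¹ := fun n =>
      Real.rpow_neg (Nat.cast_nonneg n) _
    have hD0 := variance_nonneg (fun ω => (Y 0 ω : ℝ)) P
    refine ⟨GWI.Critical.limitGen _ _ β γ, μ, fun x hx hx1 => ?_, hμ, hUi, hμs, ?_, ?_⟩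
    · refine (hc.tendsto_rpow_mul_genZ hx hx1).congr fun n => ?_
      rw [← hp.gen_eq n x hx hx1.le]
      rfl
    · simp only [hinv, hY2]
      exact GWI.isEquivalent_mul_inv (by positivity) hr (hGWI.tendsto_mul_J hH hr hU hμl)
    · simp only [hinv]
      exact GWI.isEquivalent_mul_inv (by positivity) hr (hGWI.tendsto_mul_meanCondVar hH hU hμl)
  · have h1 := hc.mul_invMoment_one_tendsto hp hσ
    have h2 := hc.mul_invMoment_two_tendsto hp hσ
    have hr := tendsto_natCast_atTop_atTop (R := ℝ)
    have hβγ : 0 < β - γ := sub_pos.2 ((one_lt_div hγ).1 hσ)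
    have hJ := hGWI.tendsto_mul_J hH hr h1 h2
    have hM := hGWI.tendsto_mul_meanCondVar hH h1 h2
    rw [mul_zero, add_zero] at hJ hM
    have e : (fun n : ℕ => 2 * γ / ((n : ℝ) * (β - γ)))
        = fun n : ℕ => 2 * γ * (1 / (β - γ)) * (n : ℝ)⁻¹ := by
      funext n; rw [mul_one_div, ← div_eq_mul_inv, div_div, mul_comm (β - γ)]
    rw [e]
    exact ⟨GWI.isEquivalent_mul_inv (by positivity) hr hJ,
      GWI.isEquivalent_mul_inv (by positivity) hr hM⟩
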